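/- Let $M$ be a smooth (finite-dimensional, Hausdorff, second countable) manifold and $Z$ a smooth bivector field on $M$. Write $Z^\sharp\xi = Z(\xi,\cdot)$ for $\xi\in T^*M$, and $\beta^\sharp v=\beta(v,\cdot)$ for a 2-form $\beta$. Let $\iota_Z$ be the contraction of differential forms with $Z$, with the convention $\iota_{X\wedge Y}=\iota_X\circ\iota_Y$. Let $R_Z$ be the unique coderivation of the graded symmetric coalgebra $\bigodot(\Omega(M)[2])$ whose quadratic Taylor coefficient is $$a\odot b\;\longmapsto\;\iota_Z(a\wedge b)-\iota_Z a\wedge b-a\wedge\iota_Z b$$ and whose other Taylor coefficients vanish. It is locally nilpotent; let $\psi=e^{R_Z}=\sum_j \frac1{j!}R_Z^j$, and let $\psi_k:\bigodot^k(\Omega(M)[2])\to\Omega(M)[2]$, $k\ge 1$, be its Taylor coefficients (its restriction to words of length $k$, followed by the projection to words of length $1$). Let $I_Z\subset\wedge^2T^*M$ be the set of all $\beta$ for which $\mathrm{id}+Z^\sharp\beta^\sharp$ is invertible, and for $\beta\in I_Z$ let $F(\beta)$ be the 2-form with $(F(\beta))^\sharp=\beta^\sharp(\mathrm{id}+Z^\sharp\beta^\sharp)^{-1}$.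 Then for every $\beta\in\Omega^2(M)$ and every $j\ge 0$, $\psi_{j+1}(\beta^{\odot (j+1)})$ is a 2-form, and $$\Big(\tfrac{1}{(j+1)!}\,\psi_{j+1}(\beta^{\odot (j+1)})\Big)^\sharp=(-1)^j\,\beta^\sharp(Z^\sharp\beta^\sharp)^j .$$ Moreover, for all sufficiently $C^0$-small $\beta$ — that is, there is an open neighbourhood $U\subset I_Z$ of the zero section of $\wedge^2T^*M$ such that for all $\beta\in\Omega^2(M)$ with values in $U$ — the form $F(\beta)$ is smooth, and the series $$\psi_*(\beta)=\sum_{k\ge1}\tfrac1{k!}\,\psi_k(\beta^{\odot k})$$ converges to $F(\beta)$ in the $C^\infty$-topology (uniform convergence of all derivatives on compact subsets of charts). In particular $\psi_*(\beta)^\sharp=\sum_{j\ge 0}(-1)^j\beta^\sharp(Z^\sharp\beta^\sharp)^j=\beta^\sharp(\mathrm{id}+Z^\sharp\beta^\sharp)^{-1}=(F(\beta))^\sharp$, where the sum over $j$ converges pointwise on $M$. -/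

import Mathlib

open scoped DirectSum TensorProduct Manifold ContDiff
open Bundle Filter Topology


noncomputable section GradedSymmetric

variable (A : ℕ → Type*) [∀ n, AddCommGroup (A n)] [∀ n, Module ℝ (A n)]

/-- The relations `x ⊗ y = (-1)^{|x||y|} y ⊗ x` for homogeneous `x`, `y`. -/
inductive KoszulRel :
    TensorAlgebra ℝ (⨁ n, A n) → TensorAlgebra ℝ (⨁ n, A n) → Prop
  | swap (m n : ℕ) (a : A m) (b : A n) :
      KoszulRel
        (TensorAlgebra.ι ℝ (DirectSum.lof ℝ ℕ A m a) * TensorAlgebra.ι ℝ (DirectSum.lof ℝ ℕ A n b))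
        ((-1 : ℝ) ^ (m * n) •
          (TensorAlgebra.ι ℝ (DirectSum.lof ℝ ℕ A n b) *
            TensorAlgebra.ι ℝ (DirectSum.lof ℝ ℕ A m a)))

/-- The graded symmetric algebra `⨀ V` of `V = ⨁ₙ Aₙ`: the tensor algebra modulo
`x ⊗ y = (-1)^{|x||y|} y ⊗ x`. An even shift of the grading, such as `V[2]`, does not change the
signs, so this is also `⨀ (V[2])`. -/
def GSym : Type _ := RingQuot (KoszulRel A)

instance : Ring (GSym A) := inferInstanceAs (Ring (RingQuot (KoszulRel A)))
instance : Algebra ℝ (GSym A) := inferInstanceAs (Algebra ℝ (RingQuot (KoszulRel A)))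

namespace GSym
variable {A}

variable (A) in
/-- The quotient map from the tensor algebra. -/
def mk : TensorAlgebra ℝ (⨁ n, A n) →ₐ[ℝ] GSym A := RingQuot.mkAlgHom ℝ (KoszulRel A)

/-- The inclusion `V → ⨀ V`. -/
def ι : (⨁ n, A n) →ₗ[ℝ] GSym A := (mk A).toLinearMap ∘ₗ TensorAlgebra.ι ℝ

/-- Graded commutativity of generators. -/
def GradedComm {B : Type*} [Semiring B] [Algebra ℝ B] (f : (⨁ n, A n) →ₗ[ℝ] B) : Prop :=
  ∀ (m n : ℕ) (a : A m) (b : A n),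
    f (DirectSum.lof ℝ ℕ A m a) * f (DirectSum.lof ℝ ℕ A n b) =
      (-1 : ℝ) ^ (m * n) • (f (DirectSum.lof ℝ ℕ A n b) * f (DirectSum.lof ℝ ℕ A m a))

theorem gradedComm_ι : GradedComm (ι (A := A)) := by
  intro m n a b
  have h : mk A _ = mk A _ := RingQuot.mkAlgHom_rel ℝ (KoszulRel.swap m n a b)
  simp only [map_mul, map_smul] at h
  exact h

/-- The universal property of `⨀ V`. -/
def lift {B : Type*} [Semiring B] [Algebra ℝ B] (f : (⨁ n, A n) →ₗ[ℝ] B) (hf : GradedComm f) :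
    GSym A →ₐ[ℝ] B :=
  RingQuot.liftAlgHom ℝ ⟨TensorAlgebra.lift ℝ f, by
    rintro _ _ ⟨m, n, a, b⟩
    simpa only [map_mul, map_smul, TensorAlgebra.lift_ι_apply] using hf m n a b⟩

@[simp]
theorem lift_ι {B : Type*} [Semiring B] [Algebra ℝ B] (f : (⨁ n, A n) →ₗ[ℝ] B) (hf : GradedComm f)
    (v : ⨁ n, A n) : lift f hf (ι v) = f v := by
  change RingQuot.liftAlgHom ℝ _ (RingQuot.mkAlgHom ℝ (KoszulRel A) (TensorAlgebra.ι ℝ v)) = f v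
  rw [RingQuot.liftAlgHom_mkAlgHom_apply, TensorAlgebra.lift_ι_apply]

theorem hom_ext' {B : Type*} [Semiring B] [Algebra ℝ B] {f g : GSym A →ₐ[ℝ] B}
    (h : ∀ v, f (ι v) = g (ι v)) : f = g := by
  apply RingQuot.ringQuot_ext'
  apply TensorAlgebra.hom_ext
  ext1 v
  apply LinearMap.ext
  intro x
  exact h _

/-- Induction: a submodule containing `1` and stable under multiplication by generators. -/
theorem induct {P : GSym A → Prop} (h1 : P 1) (hadd : ∀ s t, P s → P t → P (s + t))
    (hsmul : ∀ (c : ℝ) s, P s → P (c • s))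
    (hmul : ∀ (n : ℕ) (a : A n) s, P s → P (ι (DirectSum.lof ℝ ℕ A n a) * s)) (s : GSym A) : P s := by
  have h0 : P 0 := by simpa using hsmul 0 1 h1
  have hmul' : ∀ v s, P s → P (ι v * s) := by
    intro v s hs
    induction v using DirectSum.induction_on with
    | zero => simpa using h0
    | of n a => exact hmul n a s hs
    | add x y hx hy => rw [map_add, add_mul]; exact hadd _ _ hx hy
  let Q : Submodule ℝ (GSym A) := ⟨⟨⟨{s | P s}, fun {a b} => hadd a b⟩, h0⟩, hsmul⟩
  have key : ∀ x : TensorAlgebra ℝ (⨁ n, A n), ∀ s ∈ Q, mk A x * s ∈ Q := by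
    intro x
    induction x using TensorAlgebra.induction with
    | algebraMap r =>
      intro s hs
      rw [AlgHom.commutes, ← Algebra.smul_def]; exact Q.smul_mem _ hs
    | ι v => exact fun s hs => hmul' v s hs
    | mul a b ha hb => intro s hs; rw [map_mul, mul_assoc]; exact ha _ (hb _ hs)
    | add a b ha hb => intro s hs; rw [map_add, add_mul]; exact Q.add_mem (ha _ hs) (hb _ hs)
  obtain ⟨x, rfl⟩ : ∃ x, mk A x = s := RingQuot.mkAlgHom_surjective ℝ (KoszulRel A) s
  have h := key x 1 h1
  rw [mul_one] at h
  exact h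

variable (A) in
/-- Auxiliary operators on `ℝ × V` for the definition of `proj`. -/
def projOp : (⨁ n, A n) →ₗ[ℝ] Module.End ℝ (ℝ × ⨁ n, A n) :=
  LinearMap.mk₂ ℝ (fun x p => (0, p.1 • x))
    (by intro x y p; simp) (by intro c x p; simp [smul_comm c])
    (by intro x p q; simp [add_smul]) (by intro c x p; simp [mul_smul])

theorem projOp_comm : GradedComm (projOp A) := by
  intro m n a b
  refine LinearMap.ext fun p => ?_
  simp [projOp]

/-- The projection `p : ⨀ V → V` onto words of length one. -/
def proj : GSym A →ₗ[ℝ] ⨁ n, A n :=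
  LinearMap.snd ℝ _ _ ∘ₗ LinearMap.applyₗ ((1, 0) : ℝ × ⨁ n, A n) ∘ₗ
    (lift (projOp A) projOp_comm).toLinearMap

theorem proj_one : proj (1 : GSym A) = 0 := by
  simp [proj]

theorem proj_ι (v : ⨁ n, A n) : proj (ι v) = v := by
  simp [proj, projOp]

theorem proj_ι_mul_ι_mul (v w : ⨁ n, A n) (s : GSym A) : proj (ι v * (ι w * s)) = 0 := by
  simp [proj, projOp]

variable (A) in
/-- `x ↦ (-1)^{n |x|} x`. -/
def twist (n : ℕ) : (⨁ n, A n) →ₗ[ℝ] ⨁ n, A n :=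
  DirectSum.toModule ℝ ℕ _ fun m => (-1 : ℝ) ^ (m * n) • DirectSum.lof ℝ ℕ A m

@[simp]
theorem twist_lof (n m : ℕ) (a : A m) : twist A n (DirectSum.lof ℝ ℕ A m a) =
    (-1 : ℝ) ^ (m * n) • DirectSum.lof ℝ ℕ A m a := by
  simp [twist]

theorem ι_mul_ι (v : ⨁ n, A n) (n : ℕ) (b : A n) :
    ι v * ι (DirectSum.lof ℝ ℕ A n b) = ι (DirectSum.lof ℝ ℕ A n b) * ι (twist A n v) := by
  induction v using DirectSum.induction_on with
  | zero => simp
  | of m a =>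
    have := gradedComm_ι m n a b
    change ι (DirectSum.lof ℝ ℕ A m a) * _ = _ * ι (twist A n (DirectSum.lof ℝ ℕ A m a))
    rw [this, twist_lof, map_smul, mul_smul_comm]
  | add x y hx hy => simp only [map_add, add_mul, mul_add, hx, hy]

theorem twist_comm (m n : ℕ) (v : ⨁ n, A n) : twist A m (twist A n v) = twist A n (twist A m v) := by
  induction v using DirectSum.induction_on with
  | zero => simp
  | of k a =>
    change twist A m (twist A n (DirectSum.lof ℝ ℕ A k a)) =
      twist A n (twist A m (DirectSum.lof ℝ ℕ A k a))
    simp [smul_smul, mul_comm]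
  | add x y hx hy => simp only [map_add, hx, hy]

end GSym
variable {A}
/-- A bilinear map `K : V × V → V` that maps homogeneous elements to homogeneous elements, preserves
the parity of the degrees, and is graded symmetric, so that it is an even map `⨀² V → V`. -/
structure IsKoszulSymmetric (K : (⨁ n, A n) →ₗ[ℝ] (⨁ n, A n) →ₗ[ℝ] ⨁ n, A n) : Prop where
  parity : ∀ (m n : ℕ) (a : A m) (b : A n), ∃ (k : ℕ) (c : A k), Even (k + (m + n)) ∧
    K (DirectSum.lof ℝ ℕ A m a) (DirectSum.lof ℝ ℕ A n b) = DirectSum.lof ℝ ℕ A k c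
  symm : ∀ (m n : ℕ) (a : A m) (b : A n),
    K (DirectSum.lof ℝ ℕ A m a) (DirectSum.lof ℝ ℕ A n b) =
      (-1 : ℝ) ^ (m * n) • K (DirectSum.lof ℝ ℕ A n b) (DirectSum.lof ℝ ℕ A m a)

namespace GSym

variable (K : (⨁ n, A n) →ₗ[ℝ] (⨁ n, A n) →ₗ[ℝ] ⨁ n, A n)

theorem neg_one_pow_congr {a b : ℕ} (h : Even (a + b)) : (-1 : ℝ) ^ a = (-1) ^ b := by
  rcases Nat.even_or_odd a with ha | ha
  · rw [ha.neg_one_pow, ((Nat.even_add.1 h).1 ha).neg_one_pow]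
  · rw [ha.neg_one_pow, Odd.neg_one_pow]
    rw [← Nat.not_even_iff_odd] at ha ⊢
    exact fun hb => ha ((Nat.even_add.1 h).2 hb)

variable {K} in
theorem twist_bracket (hK : IsKoszulSymmetric K) (n : ℕ) (x y : ⨁ n, A n) :
    twist A n (K x y) = K (twist A n x) (twist A n y) := by
  induction x using DirectSum.induction_on with
  | zero => simp
  | add x x' hx hx' => simp only [map_add, LinearMap.add_apply, hx, hx']
  | of k a =>
    induction y using DirectSum.induction_on with
    | zero => simp
    | add y y' hy hy' => simp only [map_add, hy, hy']
    | of l b =>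
      change twist A n (K (DirectSum.lof ℝ ℕ A k a) (DirectSum.lof ℝ ℕ A l b)) =
        K (twist A n (DirectSum.lof ℝ ℕ A k a)) (twist A n (DirectSum.lof ℝ ℕ A l b))
      obtain ⟨p, c, hp, hc⟩ := hK.parity k l a b
      simp only [twist_lof, map_smul, LinearMap.smul_apply, smul_smul]
      rw [hc, twist_lof, ← pow_add, ← add_mul, add_comm l k]
      congr 1
      refine neg_one_pow_congr ?_
      rw [← add_mul]
      exact hp.mul_right n

/-- Auxiliary operators for the definition of `contr`, on pairs `(w, contr w)`. -/
def partialOp (n : ℕ) : A n →ₗ[ℝ] Module.End ℝ (GSym A × ((⨁ n, A n) →ₗ[ℝ] GSym A)) :=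
  LinearMap.mk₂ ℝ (fun b p => (ι (DirectSum.lof ℝ ℕ A n b) * p.1,
      LinearMap.mulLeft ℝ (ι (DirectSum.lof ℝ ℕ A n b)) ∘ₗ p.2 ∘ₗ twist A n +
        LinearMap.mulRight ℝ p.1 ∘ₗ ι ∘ₗ K.flip (DirectSum.lof ℝ ℕ A n b)))
    (by intro b b' p; ext <;> simp [add_mul]; abel)
    (by intro c b p; ext <;> simp [smul_comm c])
    (by intro b p p'; ext <;> simp [mul_add]; abel)
    (by intro c b p; ext <;> simp [smul_comm c])

/-- Auxiliary operators for the definition of `contr`. -/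
def partialAct : (⨁ n, A n) →ₗ[ℝ] Module.End ℝ (GSym A × ((⨁ n, A n) →ₗ[ℝ] GSym A)) :=
  DirectSum.toModule ℝ ℕ _ (partialOp K)

theorem partialAct_lof (n : ℕ) (b : A n) :
    partialAct K (DirectSum.lof ℝ ℕ A n b) = partialOp K n b := DirectSum.toModule_lof ..

theorem partialOp_comm (hK : IsKoszulSymmetric K) : GradedComm (partialAct K) := by
  intro n p b c
  simp only [partialAct_lof]
  set y := DirectSum.lof ℝ ℕ A n b
  set z := DirectSum.lof ℝ ℕ A p c
  have hyz : ι y * ι z = (-1 : ℝ) ^ (n * p) • (ι z * ι y) := gradedComm_ι n p b c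
  have hyn : ∀ n', twist A n' y = (-1 : ℝ) ^ (n * n') • y := fun n' => twist_lof _ _ _
  have hzn : ∀ n', twist A n' z = (-1 : ℝ) ^ (p * n') • z := fun n' => twist_lof _ _ _
  have sq : ((-1 : ℝ) ^ (n * p)) * ((-1 : ℝ) ^ (n * p)) = 1 := by
    rw [← pow_add, ← two_mul, pow_mul]; norm_num
  refine LinearMap.ext fun ⟨w, r⟩ => ?_
  apply Prod.ext
  · change ι y * (ι z * w) = (-1 : ℝ) ^ (n * p) • (ι z * (ι y * w))
    rw [← mul_assoc, hyz, smul_mul_assoc, mul_assoc]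
  · apply LinearMap.ext
    intro x
    change ι y * (ι z * r (twist A p (twist A n x)) + ι (K (twist A n x) z) * w)
        + ι (K x y) * (ι z * w) =
      (-1 : ℝ) ^ (n * p) • (ι z * (ι y * r (twist A n (twist A p x)) + ι (K (twist A p x) y) * w)
        + ι (K x z) * (ι y * w))
    have e1 : ι (K x y) * ι z = (-1 : ℝ) ^ (n * p) • (ι z * ι (K (twist A p x) y)) := by
      rw [ι_mul_ι (K x y) p c, twist_bracket hK, hyn, map_smul, map_smul, mul_smul_comm]
    have e2 : (-1 : ℝ) ^ (n * p) • (ι (K x z) * ι y) = ι y * ι (K (twist A n x) z) := by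
      rw [ι_mul_ι (K x z) n b, twist_bracket hK, hzn, map_smul, map_smul, mul_smul_comm, smul_smul,
        mul_comm p n, sq, one_smul]
    have e2' : ∀ t, (-1 : ℝ) ^ (n * p) • (ι (K x z) * (ι y * t)) =
        ι y * (ι (K (twist A n x) z) * t) := fun t => by
      rw [← mul_assoc, ← smul_mul_assoc, e2, mul_assoc]
    rw [mul_add, mul_add, ← mul_assoc (ι (K x y)), e1, smul_add, smul_add, e2',
      ← mul_assoc (ι y) (ι z), hyz, twist_comm]
    simp only [smul_mul_assoc, mul_assoc]
    abel

variable (hK : IsKoszulSymmetric K)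

/-- The sum `contr (y₁ ⊙ ⋯ ⊙ yₙ) x = ∑ᵢ ± y₁ ⊙ ⋯ ⊙ K(x, yᵢ) ⊙ ⋯ ⊙ yₙ` with the Koszul signs obtained
by moving `x` to the right up to `yᵢ`. -/
def contr : GSym A →ₗ[ℝ] (⨁ n, A n) →ₗ[ℝ] GSym A :=
  LinearMap.snd ℝ _ _ ∘ₗ LinearMap.applyₗ ((1, 0) : GSym A × _) ∘ₗ
    (lift (partialAct K) (partialOp_comm K hK)).toLinearMap

theorem contr_aux (w : GSym A) :
    (lift (partialAct K) (partialOp_comm K hK) w (1, 0)).1 = w := by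
  induction w using induct with
  | h1 => simp
  | hadd s t hs ht => simp [hs, ht]
  | hsmul c s hs => simp [hs]
  | hmul n a s hs =>
    rw [map_mul, lift_ι, partialAct_lof]
    change ι _ * _ = _
    rw [hs]

theorem contr_one (x : ⨁ n, A n) : contr K hK 1 x = 0 := by
  simp [contr]

theorem contr_mul (n : ℕ) (b : A n) (w : GSym A) (x : ⨁ n, A n) :
    contr K hK (ι (DirectSum.lof ℝ ℕ A n b) * w) x =
      ι (DirectSum.lof ℝ ℕ A n b) * contr K hK w (twist A n x) +
        ι (K x (DirectSum.lof ℝ ℕ A n b)) * w := by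
  have h : contr K hK (ι (DirectSum.lof ℝ ℕ A n b) * w) x =
      ι (DirectSum.lof ℝ ℕ A n b) * contr K hK w (twist A n x) +
        ι (K x (DirectSum.lof ℝ ℕ A n b)) *
          (lift (partialAct K) (partialOp_comm K hK) w (1, 0)).1 := by
    simp only [contr, LinearMap.coe_comp, Function.comp_apply, AlgHom.toLinearMap_apply, map_mul,
      lift_ι, partialAct_lof]
    rfl
  rw [h, contr_aux K hK]

/-- Auxiliary operators for the definition of `coder`, on pairs `(w, coder w)`. -/
def coderOp : (⨁ n, A n) →ₗ[ℝ] Module.End ℝ (GSym A × GSym A) :=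
  LinearMap.mk₂ ℝ (fun x p => (ι x * p.1, ι x * p.2 + contr K hK p.1 x))
    (by intro b b' p; ext <;> simp [add_mul]; abel)
    (by intro c b p; ext <;> simp)
    (by intro b p p'; ext <;> simp [mul_add]; abel)
    (by intro c b p; ext <;> simp)

theorem coderOp_comm : GradedComm (coderOp K hK) := by
  intro m n a b
  have hs := hK.symm m n a b
  have hxy := gradedComm_ι m n a b
  have c1 := fun w => contr_mul K hK n b w (DirectSum.lof ℝ ℕ A m a)
  have c2 := fun w => contr_mul K hK m a w (DirectSum.lof ℝ ℕ A n b)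
  rw [twist_lof] at c1 c2
  set x := DirectSum.lof ℝ ℕ A m a
  set y := DirectSum.lof ℝ ℕ A n b
  have sq : ((-1 : ℝ) ^ (m * n)) * ((-1 : ℝ) ^ (m * n)) = 1 := by
    rw [← pow_add, ← two_mul, pow_mul]; norm_num
  refine LinearMap.ext fun ⟨w, r⟩ => ?_
  apply Prod.ext
  · change ι x * (ι y * w) = (-1 : ℝ) ^ (m * n) • (ι y * (ι x * w))
    rw [← mul_assoc, hxy, smul_mul_assoc, mul_assoc]
  · change ι x * (ι y * r + contr K hK w y) + contr K hK (ι y * w) x =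
      (-1 : ℝ) ^ (m * n) • (ι y * (ι x * r + contr K hK w x) + contr K hK (ι x * w) y)
    rw [c1, c2, mul_add, mul_add, ← mul_assoc, hxy, hs, map_smul, map_smul, map_smul, mul_comm n m]
    simp only [smul_mul_assoc, mul_smul_comm, mul_assoc, smul_add, smul_smul, sq, one_smul]
    abel

/-- The coderivation of `⨀ V` with quadratic Taylor coefficient `K` and no other Taylor coefficient:
`x₁ ⊙ ⋯ ⊙ xₙ ↦ ∑_{i < j} ± K(xᵢ, xⱼ) ⊙ x₁ ⊙ ⋯ ⊙ xₙ` (with `xᵢ`, `xⱼ` omitted in the last factors),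
given recursively by `coder_one` and `coder_mul`. See `comul_coder`, `proj_coder_ι_mul_ι` and
`proj_coder_eq_zero`. -/
def coder : GSym A →ₗ[ℝ] GSym A :=
  LinearMap.snd ℝ _ _ ∘ₗ LinearMap.applyₗ ((1, 0) : GSym A × _) ∘ₗ
    (lift (coderOp K hK) (coderOp_comm K hK)).toLinearMap

theorem coder_aux (w : GSym A) : (lift (coderOp K hK) (coderOp_comm K hK) w (1, 0)).1 = w := by
  induction w using induct with
  | h1 => simp
  | hadd s t hs ht => simp [hs, ht]
  | hsmul c s hs => simp [hs]
  | hmul n a s hs =>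
    rw [map_mul, lift_ι]
    change ι _ * _ = _
    rw [hs]

theorem coder_one : coder K hK 1 = 0 := by
  simp [coder]

theorem coder_mul (x : ⨁ n, A n) (w : GSym A) :
    coder K hK (ι x * w) = ι x * coder K hK w + contr K hK w x := by
  have h : coder K hK (ι x * w) = ι x * coder K hK w +
      contr K hK (lift (coderOp K hK) (coderOp_comm K hK) w (1, 0)).1 x := by
    simp only [coder, LinearMap.coe_comp, Function.comp_apply, AlgHom.toLinearMap_apply, map_mul,
      lift_ι]
    rfl
  rw [h, coder_aux]

theorem ι_mem (v : ⨁ n, A n) : ι v ∈ LinearMap.range (ι (A := A)) := ⟨v, rfl⟩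

theorem contr_mem (k : ℕ) : ∀ w ∈ LinearMap.range (ι (A := A)) ^ k, ∀ x,
    contr K hK w x ∈ LinearMap.range (ι (A := A)) ^ k := by
  induction k with
  | zero =>
    intro w hw x
    rw [pow_zero] at hw
    obtain ⟨c, rfl⟩ := Submodule.mem_one.1 hw
    rw [Algebra.algebraMap_eq_smul_one, map_smul, LinearMap.smul_apply, contr_one, smul_zero]
    exact zero_mem _
  | succ k ih =>
    intro w hw x
    rw [pow_succ'] at hw ⊢
    refine Submodule.mul_induction_on hw ?_ ?_
    · rintro _ ⟨v, rfl⟩ s hs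
      induction v using DirectSum.induction_on with
      | zero => simp
      | of n b =>
        change contr K hK (ι (DirectSum.lof ℝ ℕ A n b) * s) x ∈ _
        rw [contr_mul]
        exact add_mem (Submodule.mul_mem_mul (ι_mem _) (ih _ hs _))
          (Submodule.mul_mem_mul (ι_mem _) hs)
      | add v v' hv hv' =>
        rw [map_add, add_mul, map_add, LinearMap.add_apply]
        exact add_mem hv hv'
    · intro s t hs ht
      rw [map_add, LinearMap.add_apply]
      exact add_mem hs ht

theorem coder_mem (k : ℕ) : ∀ w ∈ LinearMap.range (ι (A := A)) ^ (k + 1),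
    coder K hK w ∈ LinearMap.range (ι (A := A)) ^ k := by
  induction k with
  | zero =>
    intro w hw
    rw [zero_add, pow_one] at hw
    obtain ⟨v, rfl⟩ := hw
    rw [← mul_one (ι v), coder_mul, coder_one, contr_one, mul_zero, add_zero]
    exact zero_mem _
  | succ k ih =>
    intro w hw
    rw [pow_succ'] at hw
    refine Submodule.mul_induction_on hw ?_ ?_
    · rintro _ ⟨v, rfl⟩ s hs
      rw [coder_mul]
      refine add_mem ?_ (contr_mem K hK _ _ hs _)
      rw [pow_succ']
      exact Submodule.mul_mem_mul (ι_mem _) (ih _ hs)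
    · intro s t hs ht
      rw [map_add]
      exact add_mem hs ht

theorem coder_pow_eq_zero (k : ℕ) : ∀ w ∈ LinearMap.range (ι (A := A)) ^ k,
    (coder K hK ^ (k + 1)) w = 0 := by
  induction k with
  | zero =>
    intro w hw
    rw [pow_zero] at hw
    obtain ⟨c, rfl⟩ := Submodule.mem_one.1 hw
    rw [Algebra.algebraMap_eq_smul_one, map_smul, zero_add, pow_one, coder_one, smul_zero]
  | succ k ih =>
    intro w hw
    rw [pow_succ, Module.End.mul_apply]
    exact ih _ (coder_mem K hK k w hw)

theorem mem_iSup (s : GSym A) : s ∈ ⨆ k : ℕ, LinearMap.range (ι (A := A)) ^ k := by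
  induction s using induct with
  | h1 => exact Submodule.mem_iSup_of_mem 0 (by rw [pow_zero]; exact Submodule.one_le.1 le_rfl)
  | hadd s t hs ht => exact add_mem hs ht
  | hsmul c s hs => exact Submodule.smul_mem _ _ hs
  | hmul n a s hs =>
    have h := Submodule.mul_mem_mul (ι_mem (DirectSum.lof ℝ ℕ A n a)) hs
    rw [Submodule.mul_iSup] at h
    have hle : (⨆ k : ℕ, LinearMap.range (ι (A := A)) * LinearMap.range (ι (A := A)) ^ k) ≤
        ⨆ k : ℕ, LinearMap.range (ι (A := A)) ^ k := iSup_le fun k => by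
      rw [← pow_succ']
      exact le_iSup (fun k : ℕ => LinearMap.range (ι (A := A)) ^ k) (k + 1)
    exact hle h

theorem pow_apply_eq_zero {W : Type*} [AddCommGroup W] [Module ℝ W] {f : Module.End ℝ W} {w : W}
    {m n : ℕ} (h : (f ^ m) w = 0) (hmn : m ≤ n) : (f ^ n) w = 0 := by
  obtain ⟨k, rfl⟩ := Nat.exists_eq_add_of_le' hmn
  rw [pow_add, Module.End.mul_apply, h, map_zero]

theorem coder_locallyNilpotent (s : GSym A) : ∃ N, (coder K hK ^ N) s = 0 := by
  refine Submodule.iSup_induction _ (motive := fun s => ∃ N, (coder K hK ^ N) s = 0) (mem_iSup s)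
    (fun k w hw => ⟨k + 1, coder_pow_eq_zero K hK k w hw⟩) ⟨0, by simp⟩ ?_
  rintro x y ⟨m, hm⟩ ⟨n, hn⟩
  refine ⟨max m n, ?_⟩
  rw [map_add, pow_apply_eq_zero hm (le_max_left _ _), pow_apply_eq_zero hn (le_max_right _ _),
    add_zero]

/-- The exponential `∑ⱼ fʲ / j!` of a locally nilpotent endomorphism; the sum is finite on each
vector. -/
def locExp {W : Type*} [AddCommGroup W] [Module ℝ W] (f : Module.End ℝ W)
    (hf : ∀ w, ∃ N, (f ^ N) w = 0) : Module.End ℝ W :=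
  have fin : ∀ w, (Function.support fun j : ℕ => ((j.factorial : ℝ)⁻¹) • (f ^ j) w).Finite := by
    intro w
    obtain ⟨N, hN⟩ := hf w
    refine (Set.finite_lt_nat N).subset fun j hj => ?_
    by_contra hle
    exact hj (by simp [pow_apply_eq_zero hN (not_lt.1 hle)])
  { toFun := fun w => ∑ᶠ j : ℕ, ((j.factorial : ℝ)⁻¹) • (f ^ j) w
    map_add' := fun v w => by
      rw [← finsum_add_distrib (fin v) (fin w)]
      simp only [map_add, smul_add]
    map_smul' := fun c w => by
      rw [RingHom.id_apply, smul_finsum' c (fin w)]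
      simp only [map_smul, smul_comm c] }

/-- The Taylor coefficients `fₖ(x₁, …, xₖ) = p (f (x₁ ⊙ ⋯ ⊙ xₖ))` of `f : ⨀ V → ⨀ V`. -/
def taylor (f : Module.End ℝ (GSym A)) (k : ℕ) (x : Fin k → ⨁ n, A n) : ⨁ n, A n :=
  proj (f (List.ofFn fun i => ι (x i)).prod)

theorem twist_gradedComm (n : ℕ) : GradedComm (ι ∘ₗ twist A n) := by
  intro m k a b
  have h := gradedComm_ι m k a b
  simp only [LinearMap.comp_apply, twist_lof, map_smul, smul_mul_assoc, mul_smul_comm, h]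
  simp only [smul_smul]
  congr 1
  ring

variable (A) in
/-- The automorphism `s ↦ (-1)^{n|s|} s` of `⨀ V`. -/
def twistHom (n : ℕ) : GSym A →ₐ[ℝ] GSym A := lift (ι ∘ₗ twist A n) (twist_gradedComm n)

theorem twistHom_ι (n : ℕ) (v : ⨁ n, A n) : twistHom A n (ι v) = ι (twist A n v) := by
  rw [twistHom, lift_ι, LinearMap.comp_apply]

theorem twistHom_congr {m n : ℕ} (h : Even (m + n)) : twistHom A m = twistHom A n := by
  refine hom_ext' fun v => ?_
  rw [twistHom_ι, twistHom_ι]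
  congr 1
  induction v using DirectSum.induction_on with
  | zero => simp
  | of k a =>
    change twist A m (DirectSum.lof ℝ ℕ A k a) = twist A n (DirectSum.lof ℝ ℕ A k a)
    rw [twist_lof, twist_lof, neg_one_pow_congr]
    rw [← mul_add]; exact h.mul_left k
  | add x y hx hy => rw [map_add, map_add, hx, hy]

theorem twistHom_add (m n : ℕ) (s : GSym A) :
    twistHom A m (twistHom A n s) = twistHom A (m + n) s := by
  have : (twistHom A m).comp (twistHom A n) = twistHom A (m + n) := by
    refine hom_ext' fun v => ?_
    rw [AlgHom.comp_apply, twistHom_ι, twistHom_ι, twistHom_ι]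
    congr 1
    induction v using DirectSum.induction_on with
    | zero => simp
    | of k a =>
      change twist A m (twist A n (DirectSum.lof ℝ ℕ A k a)) =
        twist A (m + n) (DirectSum.lof ℝ ℕ A k a)
      rw [twist_lof, map_smul, twist_lof, twist_lof, smul_smul, ← pow_add, ← mul_add, add_comm n m]
    | add x y hx hy => simp only [map_add, hx, hy]
  exact DFunLike.congr_fun this s

/-- Left multiplication by `Δ a = a ⊗ 1 + 1 ⊗ a` on the graded tensor product `⨀ V ⊗ ⨀ V`. -/
def comulOp (n : ℕ) : A n →ₗ[ℝ] Module.End ℝ (GSym A ⊗[ℝ] GSym A) :=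
  (LinearMap.rTensorHom (GSym A) ∘ₗ LinearMap.mul ℝ (GSym A) +
    TensorProduct.mapBilinear (RingHom.id ℝ) (GSym A) (GSym A) (GSym A) (GSym A)
      (twistHom A n).toLinearMap ∘ₗ LinearMap.mul ℝ (GSym A)) ∘ₗ ι ∘ₗ DirectSum.lof ℝ ℕ A n

theorem comulOp_tmul (n : ℕ) (a : A n) (s t : GSym A) : comulOp n a (s ⊗ₜ t) =
    (ι (DirectSum.lof ℝ ℕ A n a) * s) ⊗ₜ t +
      twistHom A n s ⊗ₜ (ι (DirectSum.lof ℝ ℕ A n a) * t) := rfl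

variable (A) in
/-- Left multiplication by `Δ v` for all `v ∈ V`. -/
def comulAct : (⨁ n, A n) →ₗ[ℝ] Module.End ℝ (GSym A ⊗[ℝ] GSym A) :=
  DirectSum.toModule ℝ ℕ _ comulOp

theorem comulAct_lof (n : ℕ) (b : A n) :
    comulAct A (DirectSum.lof ℝ ℕ A n b) = comulOp n b := DirectSum.toModule_lof ..

theorem comulAct_comm : GradedComm (comulAct A) := by
  intro m n a b
  have h := gradedComm_ι m n a b
  have sq : ((-1 : ℝ) ^ (m * n)) * ((-1 : ℝ) ^ (m * n)) = 1 := by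
    rw [← pow_add, ← two_mul, pow_mul]; norm_num
  rw [comulAct_lof, comulAct_lof]
  refine TensorProduct.ext' fun s t => ?_
  simp only [Module.End.mul_apply, LinearMap.smul_apply, comulOp_tmul, map_add, map_mul, twistHom_ι,
    twist_lof, map_smul, smul_mul_assoc, twistHom_add]
  rw [← mul_assoc, h, ← mul_assoc, h, add_comm n m, mul_comm n m]
  simp only [smul_mul_assoc, mul_assoc, ← TensorProduct.smul_tmul', TensorProduct.tmul_smul,
    smul_add, smul_smul, sq, one_smul]
  abel

variable (A) in
/-- The unshuffle coproduct of `⨀ V`: the algebra map to the graded tensor product with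
`Δ v = v ⊗ 1 + 1 ⊗ v`. -/
def comul : GSym A →ₗ[ℝ] GSym A ⊗[ℝ] GSym A :=
  LinearMap.applyₗ (1 ⊗ₜ 1) ∘ₗ (lift (comulAct A) comulAct_comm).toLinearMap

theorem comul_one : comul A 1 = 1 ⊗ₜ 1 := by
  simp [comul]

theorem comul_mul (n : ℕ) (a : A n) (w : GSym A) :
    comul A (ι (DirectSum.lof ℝ ℕ A n a) * w) = comulOp n a (comul A w) := by
  simp only [comul, LinearMap.coe_comp, Function.comp_apply, AlgHom.toLinearMap_apply, map_mul,
    lift_ι, comulAct_lof]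
  rfl

theorem twistHom_contr (p : ℕ) (w : GSym A) : ∀ x,
    twistHom A p (contr K hK w x) = contr K hK (twistHom A p w) (twist A p x) := by
  induction w using induct with
  | h1 => intro x; simp [contr_one]
  | hadd s t hs ht => intro x; simp [hs, ht]
  | hsmul c s hs => intro x; simp [hs]
  | hmul n a s hs =>
    intro x
    rw [contr_mul, map_add, map_mul, map_mul, map_mul, hs, twistHom_ι, twistHom_ι,
      twist_bracket hK, twist_lof, map_smul, map_smul, map_smul, smul_mul_assoc, smul_mul_assoc,
      smul_mul_assoc, map_smul, LinearMap.smul_apply, contr_mul, smul_add, twist_comm]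

theorem twistHom_coder (p : ℕ) (w : GSym A) :
    twistHom A p (coder K hK w) = coder K hK (twistHom A p w) := by
  induction w using induct with
  | h1 => simp [coder_one]
  | hadd s t hs ht => simp [hs, ht]
  | hsmul c s hs => simp [hs]
  | hmul n a s hs =>
    rw [coder_mul, map_add, map_mul, map_mul, hs, twistHom_ι, coder_mul, twistHom_contr]

/-- The map `Δ (contr w a)` in terms of `Δ w`. -/
def contrTensor (m : ℕ) (a : A m) : Module.End ℝ (GSym A ⊗[ℝ] GSym A) :=
  TensorProduct.map ((contr K hK).flip (DirectSum.lof ℝ ℕ A m a)) LinearMap.id +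
    TensorProduct.map (twistHom A m).toLinearMap ((contr K hK).flip (DirectSum.lof ℝ ℕ A m a))

theorem contrTensor_tmul (m : ℕ) (a : A m) (s t : GSym A) : contrTensor K hK m a (s ⊗ₜ t) =
    contr K hK s (DirectSum.lof ℝ ℕ A m a) ⊗ₜ t +
      twistHom A m s ⊗ₜ contr K hK t (DirectSum.lof ℝ ℕ A m a) := rfl

theorem comul_contr (m : ℕ) (a : A m) (w : GSym A) :
    comul A (contr K hK w (DirectSum.lof ℝ ℕ A m a)) = contrTensor K hK m a (comul A w) := by
  induction w using induct with
  | h1 => simp [contr_one, comul_one, contrTensor_tmul]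
  | hadd s t hs ht => simp [hs, ht]
  | hsmul c s hs => simp [hs]
  | hmul n b s hs =>
    obtain ⟨k, c, hk, hc⟩ := hK.parity m n a b
    have key : contrTensor K hK m a * comulOp n b =
        (-1 : ℝ) ^ (m * n) • (comulOp n b * contrTensor K hK m a) + comulOp k c := by
      refine TensorProduct.ext' fun s t => ?_
      have sq : ((-1 : ℝ) ^ (m * n)) * ((-1 : ℝ) ^ (m * n)) = 1 := by
        rw [← pow_add, ← two_mul, pow_mul]; norm_num
      have h1 := twistHom_contr K hK n s (DirectSum.lof ℝ ℕ A m a)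
      have h2 : contr K hK (twistHom A n s) (DirectSum.lof ℝ ℕ A m a) =
          (-1 : ℝ) ^ (m * n) • twistHom A n (contr K hK s (DirectSum.lof ℝ ℕ A m a)) := by
        rw [h1, twist_lof, map_smul, smul_smul, sq, one_smul]
      simp only [Module.End.mul_apply, LinearMap.add_apply, LinearMap.smul_apply, comulOp_tmul,
        contrTensor_tmul, map_add, map_mul, contr_mul, twist_lof, map_smul, h2, hc, twistHom_ι,
        smul_mul_assoc, mul_smul_comm, twistHom_add, ← TensorProduct.smul_tmul',
        TensorProduct.tmul_smul, TensorProduct.add_tmul, TensorProduct.tmul_add, smul_add,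
        twistHom_congr hk]
      rw [add_comm n m, mul_comm n m]
      abel
    have h := LinearMap.congr_fun key (comul A s)
    simp only [Module.End.mul_apply, LinearMap.add_apply, LinearMap.smul_apply] at h
    rw [contr_mul, twist_lof, hc, map_smul, mul_smul_comm, map_add, map_smul, comul_mul, comul_mul,
      comul_mul, hs, h]

/-- `R = coder K` is an (even) coderivation: `Δ ∘ R = (R ⊗ id + id ⊗ R) ∘ Δ`. -/
theorem comul_coder : comul A ∘ₗ coder K hK =
    (TensorProduct.map (coder K hK) LinearMap.id + TensorProduct.map LinearMap.id (coder K hK)) ∘ₗ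
      comul A := by
  refine LinearMap.ext fun w => ?_
  simp only [LinearMap.comp_apply]
  induction w using induct with
  | h1 => simp [coder_one, comul_one]
  | hadd s t hs ht => simp only [map_add, hs, ht]
  | hsmul c s hs => simp only [map_smul, hs]
  | hmul n b s hs =>
    have key : (TensorProduct.map (coder K hK) LinearMap.id +
          TensorProduct.map LinearMap.id (coder K hK)) ∘ₗ comulOp n b =
        comulOp n b ∘ₗ (TensorProduct.map (coder K hK) LinearMap.id +
          TensorProduct.map LinearMap.id (coder K hK)) + contrTensor K hK n b := by
      refine TensorProduct.ext' fun s t => ?_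
      simp only [LinearMap.comp_apply, LinearMap.add_apply, comulOp_tmul, TensorProduct.map_tmul,
        LinearMap.id_apply, map_add, coder_mul, contrTensor_tmul, twistHom_coder,
        TensorProduct.add_tmul, TensorProduct.tmul_add]
      abel
    have h := LinearMap.congr_fun key (comul A s)
    simp only [LinearMap.comp_apply, LinearMap.add_apply] at h hs ⊢
    rw [coder_mul, map_add, comul_mul, comul_mul, hs, comul_contr, h]

theorem coder_ι (x : ⨁ n, A n) : coder K hK (ι x) = 0 := by
  rw [← mul_one (ι x), coder_mul, coder_one, contr_one, mul_zero, add_zero]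

/-- The quadratic Taylor coefficient of `R` is `K`. -/
theorem proj_coder_ι_mul_ι (x y : ⨁ n, A n) : proj (coder K hK (ι x * ι y)) = K x y := by
  rw [coder_mul, coder_ι, mul_zero, zero_add]
  suffices h : contr K hK (ι y) x = ι (K x y) by rw [h, proj_ι]
  induction y using DirectSum.induction_on with
  | zero => simp
  | of n b =>
    change contr K hK (ι (DirectSum.lof ℝ ℕ A n b)) x = ι (K x (DirectSum.lof ℝ ℕ A n b))
    rw [← mul_one (ι (DirectSum.lof ℝ ℕ A n b)), contr_mul, contr_one, mul_zero, zero_add, mul_one]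
  | add y z hy hz => simp only [map_add, LinearMap.add_apply, hy, hz]

theorem proj_eq_zero (k : ℕ) : ∀ w ∈ LinearMap.range (ι (A := A)) ^ (k + 2), proj w = 0 := by
  intro w hw
  rw [pow_succ', pow_succ'] at hw
  refine Submodule.mul_induction_on hw ?_ fun s t hs ht => by rw [map_add, hs, ht, add_zero]
  rintro _ ⟨v, rfl⟩ s hs
  refine Submodule.mul_induction_on hs ?_ fun s t hs ht => by
    rw [mul_add, map_add, hs, ht, add_zero]
  rintro _ ⟨u, rfl⟩ s -
  exact proj_ι_mul_ι_mul v u s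

/-- The other Taylor coefficients of `R` vanish. -/
theorem proj_coder_eq_zero (k : ℕ) (hk : k ≠ 2) : ∀ w ∈ LinearMap.range (ι (A := A)) ^ k,
    proj (coder K hK w) = 0 := by
  intro w hw
  match k, hk with
  | 0, _ =>
    rw [pow_zero] at hw
    obtain ⟨c, rfl⟩ := Submodule.mem_one.1 hw
    rw [Algebra.algebraMap_eq_smul_one, map_smul, coder_one, smul_zero, map_zero]
  | 1, _ =>
    rw [pow_one] at hw
    obtain ⟨v, rfl⟩ := hw
    rw [coder_ι, map_zero]
  | k + 3, _ => exact proj_eq_zero k _ (coder_mem K hK (k + 2) w hw)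

end GSym
end GradedSymmetric


noncomputable section GradedProducts

variable {A : ℕ → Type*} [∀ n, AddCommGroup (A n)] [∀ n, Module ℝ (A n)]
  (mul : ∀ m n, A m →ₗ[ℝ] A n →ₗ[ℝ] A (m + n)) (con : ∀ n, A (n + 2) →ₗ[ℝ] A n)

/-- The product on `⨁ₙ Aₙ` with homogeneous components `Aₘ × Aₙ → Aₘ₊ₙ`. -/
def totalMul : (⨁ n, A n) →ₗ[ℝ] (⨁ n, A n) →ₗ[ℝ] ⨁ n, A n :=
  DirectSum.toModule ℝ ℕ _ fun m => LinearMap.flip <| DirectSum.toModule ℝ ℕ _ fun n =>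
    LinearMap.flip <| (mul m n).compr₂ (DirectSum.lof ℝ ℕ A (m + n))

theorem totalMul_lof {m n : ℕ} (a : A m) (b : A n) :
    totalMul mul (DirectSum.lof ℝ ℕ A m a) (DirectSum.lof ℝ ℕ A n b) =
      DirectSum.lof ℝ ℕ A (m + n) (mul m n a b) := by
  simp [totalMul]

/-- The operator of degree `-2` on `⨁ₙ Aₙ` with homogeneous components `Aₙ₊₂ → Aₙ`; it vanishes on
`A₀` and `A₁`. -/
def totalCon : (⨁ n, A n) →ₗ[ℝ] ⨁ n, A n :=
  DirectSum.toModule ℝ ℕ _ fun m => match m with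
    | 0 => 0
    | 1 => 0
    | n + 2 => DirectSum.lof ℝ ℕ A n ∘ₗ con n

theorem totalCon_add_two {n : ℕ} (a : A (n + 2)) : totalCon con (DirectSum.lof ℝ ℕ A (n + 2) a) =
    DirectSum.lof ℝ ℕ A n (con n a) := by
  simp [totalCon]

theorem totalCon_lt_two {n : ℕ} (hn : n < 2) (a : A n) :
    totalCon con (DirectSum.lof ℝ ℕ A n a) = 0 := by
  match n, hn with
  | 0, _ => simp [totalCon]
  | 1, _ => simp [totalCon]

/-- The failure of an operator `f` to be a derivation of a product,
`(a, b) ↦ f (a b) - f(a) b - a f(b)`, for `f` of even degree. -/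
def derivationDefect : (⨁ n, A n) →ₗ[ℝ] (⨁ n, A n) →ₗ[ℝ] ⨁ n, A n :=
  LinearMap.mk₂ ℝ
    (fun a b => totalCon con (totalMul mul a b) - totalMul mul (totalCon con a) b -
      totalMul mul a (totalCon con b))
    (fun a a' b => by simp only [map_add, LinearMap.add_apply]; abel)
    (fun c a b => by simp only [map_smul, LinearMap.smul_apply, smul_sub])
    (fun a b b' => by simp only [map_add]; abel)
    (fun c a b => by simp only [map_smul, smul_sub])

theorem derivationDefect_apply (a b : ⨁ n, A n) : derivationDefect mul con a b =
    totalCon con (totalMul mul a b) - totalMul mul (totalCon con a) b -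
      totalMul mul a (totalCon con b) := rfl

variable {mul} in
theorem totalMul_totalCon_comm (hmul : ∀ (m n : ℕ) (a : A m) (b : A n),
      totalMul mul (DirectSum.lof ℝ ℕ A m a) (DirectSum.lof ℝ ℕ A n b) =
      (-1 : ℝ) ^ (m * n) • totalMul mul (DirectSum.lof ℝ ℕ A n b) (DirectSum.lof ℝ ℕ A m a))
    {m n : ℕ} (a : A m) (b : A n) :
    totalMul mul (totalCon con (DirectSum.lof ℝ ℕ A m a)) (DirectSum.lof ℝ ℕ A n b) =
      (-1 : ℝ) ^ (m * n) • totalMul mul (DirectSum.lof ℝ ℕ A n b)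
        (totalCon con (DirectSum.lof ℝ ℕ A m a)) := by
  by_cases hm : m < 2
  · rw [totalCon_lt_two con hm]; simp
  · obtain ⟨p, rfl⟩ : ∃ p, m = p + 2 := ⟨m - 2, by omega⟩
    rw [totalCon_add_two, hmul, add_mul, pow_add, pow_mul _ 2 n]
    simp

/-- If the product is graded commutative, the derivation defect is graded symmetric. -/
theorem derivationDefect_isKoszulSymmetric (hmul : ∀ (m n : ℕ) (a : A m) (b : A n),
      totalMul mul (DirectSum.lof ℝ ℕ A m a) (DirectSum.lof ℝ ℕ A n b) =
      (-1 : ℝ) ^ (m * n) • totalMul mul (DirectSum.lof ℝ ℕ A n b) (DirectSum.lof ℝ ℕ A m a)) :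
    IsKoszulSymmetric (derivationDefect mul con) where
  parity := by
    intro m n a b
    by_cases hmn : m + n < 2
    · refine ⟨m + n, 0, ⟨m + n, rfl⟩, ?_⟩
      rw [derivationDefect_apply, totalMul_lof, totalCon_lt_two con hmn,
        totalCon_lt_two con (by omega), totalCon_lt_two con (by omega)]
      simp
    · obtain ⟨q, hq⟩ : ∃ q, m + n = q + 2 := ⟨m + n - 2, by omega⟩
      suffices h : derivationDefect mul con (DirectSum.lof ℝ ℕ A m a) (DirectSum.lof ℝ ℕ A n b) ∈
          LinearMap.range (DirectSum.lof ℝ ℕ A q) by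
        obtain ⟨c, hc⟩ := h
        exact ⟨q, c, ⟨q + 1, by omega⟩, hc.symm⟩
      rw [derivationDefect_apply]
      refine sub_mem (sub_mem ?_ ?_) ?_
      · rw [totalMul_lof]
        have : ∀ (p : ℕ) (_ : p = q + 2) (c : A p),
            totalCon con (DirectSum.lof ℝ ℕ A p c) ∈ LinearMap.range (DirectSum.lof ℝ ℕ A q) := by
          rintro _ rfl c
          exact ⟨_, (totalCon_add_two con c).symm⟩
        exact this _ hq _
      · by_cases hm : m < 2
        · rw [totalCon_lt_two con hm]; simp
        · obtain ⟨p, rfl⟩ : ∃ p, m = p + 2 := ⟨m - 2, by omega⟩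
          obtain rfl : q = p + n := by omega
          rw [totalCon_add_two, totalMul_lof]
          exact ⟨_, rfl⟩
      · by_cases hn : n < 2
        · rw [totalCon_lt_two con hn]; simp
        · obtain ⟨p, rfl⟩ : ∃ p, n = p + 2 := ⟨n - 2, by omega⟩
          obtain rfl : q = m + p := by omega
          rw [totalCon_add_two, totalMul_lof]
          exact ⟨_, rfl⟩
  symm := by
    intro m n a b
    have sq : ((-1 : ℝ) ^ (m * n)) * ((-1 : ℝ) ^ (m * n)) = 1 := by
      rw [← pow_add, ← two_mul, pow_mul]; norm_num
    rw [derivationDefect_apply, derivationDefect_apply, hmul m n a b,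
      totalMul_totalCon_comm con hmul a b, totalMul_totalCon_comm con hmul b a, mul_comm n m,
      map_smul, smul_sub, smul_sub, smul_smul, sq, one_smul]
    abel

end GradedProducts

noncomputable section LinearAlg
namespace AltForm

variable {V : Type*} [AddCommGroup V] [Module ℝ V] [TopologicalSpace V]

/-- The exterior product
`(a ∧ b)(v₁,…,vₘ₊ₙ) = 1/(m! n!) ∑_σ sgn σ a(v_σ(1),…,v_σ(m)) b(v_σ(m+1),…,v_σ(m+n))`. -/
def wedge {m n : ℕ} (a : V [⋀^Fin m]→L[ℝ] ℝ) (b : V [⋀^Fin n]→L[ℝ] ℝ) :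
    V [⋀^Fin (m + n)]→L[ℝ] ℝ :=
  ((m.factorial : ℝ)⁻¹ * (n.factorial : ℝ)⁻¹) • ContinuousMultilinearMap.alternatization
    { toFun := fun v => a (v ∘ Fin.castAdd n) * b (v ∘ Fin.natAdd m)
      map_update_add' := by
        intro inst v i x y
        obtain rfl : inst = instDecidableEqFin (m + n) := Subsingleton.elim _ _
        refine Fin.addCases (fun j => ?_) (fun j => ?_) i
        · simp only [Function.update_comp_eq_of_injective _ (Fin.castAdd_injective m n),
            Function.update_comp_eq_of_notMem_range _ _ (show Fin.castAdd n j ∉ Set.range (Fin.natAdd m) by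
              rintro ⟨k, hk⟩; simp [Fin.ext_iff] at hk; omega), a.map_update_add, add_mul]
        · simp only [Function.update_comp_eq_of_injective _ (Fin.natAdd_injective n m),
            Function.update_comp_eq_of_notMem_range _ _ (show Fin.natAdd m j ∉ Set.range (Fin.castAdd n) by
              rintro ⟨k, hk⟩; simp [Fin.ext_iff] at hk; omega), b.map_update_add, mul_add]
      map_update_smul' := by
        intro inst v i c x
        obtain rfl : inst = instDecidableEqFin (m + n) := Subsingleton.elim _ _
        refine Fin.addCases (fun j => ?_) (fun j => ?_) i
        · simp only [Function.update_comp_eq_of_injective _ (Fin.castAdd_injective m n),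
            Function.update_comp_eq_of_notMem_range _ _ (show Fin.castAdd n j ∉ Set.range (Fin.natAdd m) by
              rintro ⟨k, hk⟩; simp [Fin.ext_iff] at hk; omega), a.map_update_smul, smul_mul_assoc]
        · simp only [Function.update_comp_eq_of_injective _ (Fin.natAdd_injective n m),
            Function.update_comp_eq_of_notMem_range _ _ (show Fin.natAdd m j ∉ Set.range (Fin.castAdd n) by
              rintro ⟨k, hk⟩; simp [Fin.ext_iff] at hk; omega), b.map_update_smul, mul_smul_comm]
      cont := (a.cont.comp (by fun_prop)).mul (b.cont.comp (by fun_prop)) }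

theorem wedge_apply {m n : ℕ} (a : V [⋀^Fin m]→L[ℝ] ℝ) (b : V [⋀^Fin n]→L[ℝ] ℝ)
    (v : Fin (m + n) → V) : wedge a b v = ((m.factorial : ℝ)⁻¹ * (n.factorial : ℝ)⁻¹) *
      ∑ σ : Equiv.Perm (Fin (m + n)), Equiv.Perm.sign σ •
        (a (v ∘ σ ∘ Fin.castAdd n) * b (v ∘ σ ∘ Fin.natAdd m)) := by
  rw [wedge, ContinuousAlternatingMap.smul_apply, ContinuousMultilinearMap.alternatization_apply_apply]
  rfl

theorem finRotate_pow_val (m k : ℕ) (i : Fin m) : ((finRotate m ^ k) i : ℕ) = (i + k) % m := by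
  induction k with
  | zero => simp [Nat.mod_eq_of_lt i.2]
  | succ k ih =>
    cases m with
    | zero => exact i.elim0
    | succ m =>
      rw [pow_succ', Equiv.Perm.mul_apply, finRotate_apply, Fin.val_add, ih, Fin.val_one',
        ← Nat.add_mod, add_assoc]

theorem sign_finAddFlip (m n : ℕ) :
    Equiv.Perm.sign ((finAddFlip : Fin (m + n) ≃ Fin (n + m)).trans (finCongr (add_comm n m))) =
      (-1) ^ (m * n) := by
  have h : (finAddFlip : Fin (m + n) ≃ Fin (n + m)).trans (finCongr (add_comm n m)) =
      finRotate (m + n) ^ n := by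
    ext i
    rw [finRotate_pow_val]
    refine Fin.addCases (fun j => ?_) (fun j => ?_) i
    · have := j.2
      simp only [Equiv.trans_apply, finAddFlip_apply_castAdd, finCongr_apply, Fin.val_cast,
        Fin.val_castAdd, Fin.val_natAdd]
      rw [Nat.mod_eq_of_lt (by omega), add_comm]
    · have := j.2
      simp only [Equiv.trans_apply, finAddFlip_apply_natAdd, finCongr_apply, Fin.val_cast,
        Fin.val_castAdd, Fin.val_natAdd]
      rw [show m + (j : ℕ) + n = j + (m + n) by ring, Nat.add_mod_right,
        Nat.mod_eq_of_lt (by omega)]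
  rw [h, map_pow, sign_finRotate, ← pow_mul]
  cases n with
  | zero => simp
  | succ n =>
    rw [show (m + (n + 1) - 1) * (n + 1) = m * (n + 1) + n * (n + 1) by
      rw [show m + (n + 1) - 1 = m + n by omega]; ring, pow_add, (Nat.even_mul_succ_self n).neg_one_pow,
      mul_one]

theorem wedge_comm {m n : ℕ} (a : V [⋀^Fin m]→L[ℝ] ℝ) (b : V [⋀^Fin n]→L[ℝ] ℝ)
    (v : Fin (m + n) → V) :
    wedge a b v = (-1) ^ (m * n) * wedge b a (v ∘ finCongr (add_comm n m)) := by
  rw [wedge_apply, wedge_apply, mul_left_comm, mul_comm (m.factorial : ℝ)⁻¹]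
  congr 1
  rw [Finset.mul_sum]
  set τ : Equiv.Perm (Fin (m + n)) :=
    (finAddFlip : Fin (m + n) ≃ Fin (n + m)).trans (finCongr (add_comm n m)) with hτ
  refine Fintype.sum_equiv (((Equiv.mulRight τ⁻¹).trans
    (finCongr (add_comm m n)).permCongr)) _ _ fun σ => ?_
  have hs : Equiv.Perm.sign (((Equiv.mulRight τ⁻¹).trans
      (finCongr (add_comm m n)).permCongr) σ) = Equiv.Perm.sign σ * (-1) ^ (m * n) := by
    rw [Equiv.trans_apply, Equiv.Perm.sign_permCongr, Equiv.coe_mulRight, Equiv.Perm.sign_mul,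
      Equiv.Perm.sign_inv, sign_finAddFlip]
  have h1 : ∀ j : Fin m, τ⁻¹ (finCongr (add_comm n m) (Fin.natAdd n j)) = Fin.castAdd n j := by
    intro j
    rw [Equiv.Perm.inv_eq_iff_eq, hτ]
    simp
  have h2 : ∀ j : Fin n, τ⁻¹ (finCongr (add_comm n m) (Fin.castAdd m j)) = Fin.natAdd m j := by
    intro j
    rw [Equiv.Perm.inv_eq_iff_eq, hτ]
    simp
  have e1 : (v ∘ finCongr (add_comm n m)) ∘ (((Equiv.mulRight τ⁻¹).trans
      (finCongr (add_comm m n)).permCongr) σ) ∘ Fin.natAdd n = v ∘ σ ∘ Fin.castAdd n := by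
    funext j
    simpa [Equiv.permCongr_apply] using congrArg (fun k => v (σ k)) (h1 j)
  have e2 : (v ∘ finCongr (add_comm n m)) ∘ (((Equiv.mulRight τ⁻¹).trans
      (finCongr (add_comm m n)).permCongr) σ) ∘ Fin.castAdd m = v ∘ σ ∘ Fin.natAdd m := by
    funext j
    simpa [Equiv.permCongr_apply] using congrArg (fun k => v (σ k)) (h2 j)
  rw [hs, e1, e2]
  rcases Int.units_eq_one_or (Equiv.Perm.sign σ) with h | h <;>
  rcases neg_one_pow_eq_or ℝ (m * n) with h' | h' <;>
  rcases Nat.even_or_odd (m * n) with h'' | h'' <;>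
  simp [h, h''.neg_one_pow, mul_comm]

/-- The interior product `ι_X a = a(X, ·, …, ·)`. -/
def interiorProduct {n : ℕ} (X : V) (a : V [⋀^Fin (n + 1)]→L[ℝ] ℝ) : V [⋀^Fin n]→L[ℝ] ℝ :=
  { a.toAlternatingMap.curryLeft X with
    cont := a.cont.comp (by
      refine continuous_pi fun i => ?_
      refine Fin.cases ?_ (fun j => ?_) i
      · exact continuous_const
      · exact continuous_apply j) }

theorem interiorProduct_apply {n : ℕ} (X : V) (a : V [⋀^Fin (n + 1)]→L[ℝ] ℝ) (v : Fin n → V) :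
    interiorProduct X a v = a (Matrix.vecCons X v) := rfl

theorem wedge_comp {W : Type*} [AddCommGroup W] [Module ℝ W] [TopologicalSpace W] {m n : ℕ}
    (a : V [⋀^Fin m]→L[ℝ] ℝ) (b : V [⋀^Fin n]→L[ℝ] ℝ) (φ : W →L[ℝ] V) :
    (wedge a b).compContinuousLinearMap φ =
      wedge (a.compContinuousLinearMap φ) (b.compContinuousLinearMap φ) := by
  ext v
  rw [ContinuousAlternatingMap.compContinuousLinearMap_apply, wedge_apply, wedge_apply]
  rfl

/-- `β♯ : V → V*`, `β♯ v = β(v, ·)`. -/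
def formSharp [IsTopologicalAddGroup V] [ContinuousSMul ℝ V]
    (β : V [⋀^Fin 2]→L[ℝ] ℝ) : V →ₗ[ℝ] V →L[ℝ] ℝ where
  toFun v :=
    { toFun := fun w => β ![v, w]
      map_add' := fun w w' => by
        exact (interiorProduct v β).toAlternatingMap.map_vecCons_add ![] w w'
      map_smul' := fun c w => by
        exact (interiorProduct v β).toAlternatingMap.map_vecCons_smul ![] c w
      cont := β.cont.comp (by fun_prop) }
  map_add' v v' := by
    ext w
    exact β.toAlternatingMap.map_vecCons_add ![w] v v'
  map_smul' c v := by
    ext w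
    exact β.toAlternatingMap.map_vecCons_smul ![w] c v

theorem formSharp_apply [IsTopologicalAddGroup V] [ContinuousSMul ℝ V]
    (β : V [⋀^Fin 2]→L[ℝ] ℝ) (v w : V) : formSharp β v w = β ![v, w] := rfl

variable [IsTopologicalAddGroup V] [ContinuousSMul ℝ V] [T2Space V] [FiniteDimensional ℝ V]

/-- The dual basis. -/
def dualCoord {ι : Type*} (b : Module.Basis ι ℝ V) (i : ι) : V →L[ℝ] ℝ :=
  LinearMap.toContinuousLinearMap (b.coord i)

@[simp]
theorem dualCoord_apply {ι : Type*} (b : Module.Basis ι ℝ V) (i : ι) (v : V) :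
    dualCoord b i v = b.repr v i := rfl

/-- `Z♯ : V* → V`, `Z♯ ξ = Z(ξ, ·)` under `V = V**`, for a bivector `Z`, seen as an alternating
bilinear form on `V*`; see `apply_bivectorSharp`. -/
def bivectorSharp (Z : (V →L[ℝ] ℝ) [⋀^Fin 2]→L[ℝ] ℝ) : (V →L[ℝ] ℝ) →ₗ[ℝ] V where
  toFun ξ := ∑ i, Z ![ξ, dualCoord (Module.finBasis ℝ V) i] • Module.finBasis ℝ V i
  map_add' ξ ξ' := by
    simp only [← formSharp_apply, map_add, add_apply, add_smul, Finset.sum_add_distrib]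
  map_smul' c ξ := by
    simp only [← formSharp_apply, map_smul, smul_apply, Finset.smul_sum, smul_smul, smul_eq_mul,
      RingHom.id_apply]

theorem dual_eq_sum {ι : Type*} [Fintype ι] (b : Module.Basis ι ℝ V) (η : V →L[ℝ] ℝ) :
    η = ∑ i, η (b i) • dualCoord b i := by
  ext v
  conv_lhs => rw [← b.sum_repr v]
  simp only [map_sum, map_smul, _root_.sum_apply, _root_.smul_apply, dualCoord_apply,
    smul_eq_mul, mul_comm]

/-- `Z♯ξ = Z(ξ,·)` -/
theorem apply_bivectorSharp (Z : (V →L[ℝ] ℝ) [⋀^Fin 2]→L[ℝ] ℝ) (ξ η : V →L[ℝ] ℝ) :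
    η (bivectorSharp Z ξ) = Z ![ξ, η] := by
  rw [← formSharp_apply Z ξ η]
  conv_rhs => rw [dual_eq_sum (Module.finBasis ℝ V) η]
  change η (∑ i, Z ![ξ, dualCoord (Module.finBasis ℝ V) i] • Module.finBasis ℝ V i) = _
  simp [map_sum, formSharp_apply, mul_comm]

/-- The contraction `ι_Z`, determined by `ι_{X ∧ Y} = ι_X ∘ ι_Y`, i.e. `½ ∑ᵢⱼ Zⁱʲ ι_{eᵢ} ι_{eⱼ}` with
`Zⁱʲ = Z(eⁱ, eʲ)`; see `contraction_decomposable`. -/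
def contraction (Z : (V →L[ℝ] ℝ) [⋀^Fin 2]→L[ℝ] ℝ) {n : ℕ} (a : V [⋀^Fin (n + 2)]→L[ℝ] ℝ) :
    V [⋀^Fin n]→L[ℝ] ℝ :=
  (2 : ℝ)⁻¹ • ∑ i, ∑ j, Z ![dualCoord (Module.finBasis ℝ V) i, dualCoord (Module.finBasis ℝ V) j] •
    interiorProduct (Module.finBasis ℝ V i) (interiorProduct (Module.finBasis ℝ V j) a)

theorem contraction_apply (Z : (V →L[ℝ] ℝ) [⋀^Fin 2]→L[ℝ] ℝ) {n : ℕ}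
    (a : V [⋀^Fin (n + 2)]→L[ℝ] ℝ) (v : Fin n → V) :
    contraction Z a v = (2 : ℝ)⁻¹ * ∑ i, ∑ j,
      Z ![dualCoord (Module.finBasis ℝ V) i, dualCoord (Module.finBasis ℝ V) j] *
        a (Matrix.vecCons (Module.finBasis ℝ V j) (Matrix.vecCons (Module.finBasis ℝ V i) v)) := by
  simp only [contraction, ContinuousAlternatingMap.smul_apply,
    ContinuousAlternatingMap.sum_apply, smul_eq_mul, interiorProduct_apply]

theorem sum_dual_basis {N ι κ : Type*} [AddCommGroup N] [Module ℝ N] [Fintype ι] [Fintype κ]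
    (b : Module.Basis ι ℝ V) (c : Module.Basis κ ℝ V) (g : (V →L[ℝ] ℝ) →ₗ[ℝ] V →ₗ[ℝ] N) :
    ∑ i, g (dualCoord b i) (b i) = ∑ k, g (dualCoord c k) (c k) := by
  have h : ∀ i, g (dualCoord b i) (b i) =
      ∑ k, g (dualCoord c k) (dualCoord b i (c k) • b i) := fun i => by
    conv_lhs => rw [dual_eq_sum c (dualCoord b i)]
    simp
  simp_rw [h]
  rw [Finset.sum_comm]
  refine Finset.sum_congr rfl fun k _ => ?_
  rw [← map_sum]
  congr 1
  exact b.sum_repr (c k)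

/-- The contraction does not depend on the basis. -/
theorem contraction_apply_basis {ι : Type*} [Fintype ι] (c : Module.Basis ι ℝ V)
    (Z : (V →L[ℝ] ℝ) [⋀^Fin 2]→L[ℝ] ℝ) {n : ℕ} (a : V [⋀^Fin (n + 2)]→L[ℝ] ℝ) (v : Fin n → V) :
    contraction Z a v = (2 : ℝ)⁻¹ * ∑ i, ∑ j, Z ![dualCoord c i, dualCoord c j] *
        a (Matrix.vecCons (c j) (Matrix.vecCons (c i) v)) := by
  rw [contraction_apply]
  congr 1
  have hadd := fun x y w => a.toAlternatingMap.map_vecCons_add (n := n + 1) w x y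
  have hsmul := fun (t : ℝ) x w => a.toAlternatingMap.map_vecCons_smul (n := n + 1) w t x
  have hadd2 := fun x x' y => (interiorProduct y a).toAlternatingMap.map_vecCons_add v x x'
  have hsmul2 := fun (t : ℝ) x y => (interiorProduct y a).toAlternatingMap.map_vecCons_smul v t x
  -- the bilinear form `(x, y) ↦ a (y, x, v)`
  let f : V →ₗ[ℝ] V →ₗ[ℝ] ℝ := LinearMap.mk₂ ℝ
    (fun x y => a (Matrix.vecCons y (Matrix.vecCons x v)))
    (fun x x' y => hadd2 x x' y) (fun t x y => hsmul2 t x y)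
    (fun x y y' => hadd y y' _) (fun t x y => hsmul t y _)
  let z : (V →L[ℝ] ℝ) →ₗ[ℝ] (V →L[ℝ] ℝ) →ₗ[ℝ] ℝ :=
    (ContinuousLinearMap.coeLM ℝ) ∘ₗ formSharp Z
  change ∑ i, ∑ j, z (dualCoord (Module.finBasis ℝ V) i) (dualCoord (Module.finBasis ℝ V) j) *
      f (Module.finBasis ℝ V i) (Module.finBasis ℝ V j) =
    ∑ i, ∑ j, z (dualCoord c i) (dualCoord c j) * f (c i) (c j)
  have h1 : ∀ ξ x, ∑ j, z ξ (dualCoord (Module.finBasis ℝ V) j) * f x (Module.finBasis ℝ V j) =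
      ∑ j, z ξ (dualCoord c j) * f x (c j) := fun ξ x =>
    sum_dual_basis (Module.finBasis ℝ V) c
      (LinearMap.mk₂ ℝ (fun η y => z ξ η * f x y) (by intros; simp [add_mul])
        (by intros; simp [mul_assoc]) (by intros; simp [mul_add])
        (by intros; simp [mul_left_comm]))
  simp_rw [h1]
  exact sum_dual_basis (Module.finBasis ℝ V) c
    (LinearMap.mk₂ ℝ (fun ξ x => ∑ j, z ξ (dualCoord c j) * f x (c j))
      (by intros; simp [add_mul, Finset.sum_add_distrib])
      (by intros; simp [mul_assoc, Finset.mul_sum])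
      (by intros; simp [mul_add, Finset.sum_add_distrib])
      (by intros; simp [mul_left_comm, Finset.mul_sum]))

/-- For decomposable `Z = X ∧ Y`, contraction is `ι_X ∘ ι_Y`. -/
theorem contraction_decomposable (X Y : V) (Z : (V →L[ℝ] ℝ) [⋀^Fin 2]→L[ℝ] ℝ)
    (hZ : ∀ ξ η : V →L[ℝ] ℝ, Z ![ξ, η] = ξ X * η Y - ξ Y * η X) {n : ℕ}
    (a : V [⋀^Fin (n + 2)]→L[ℝ] ℝ) : contraction Z a = interiorProduct X (interiorProduct Y a) := by
  ext v
  rw [contraction_apply]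
  have hadd := fun x y w => a.toAlternatingMap.map_vecCons_add (n := n + 1) w x y
  have hsmul := fun (t : ℝ) x w => a.toAlternatingMap.map_vecCons_smul (n := n + 1) w t x
  have hadd2 := fun x x' y => (interiorProduct y a).toAlternatingMap.map_vecCons_add v x x'
  have hsmul2 := fun (t : ℝ) x y => (interiorProduct y a).toAlternatingMap.map_vecCons_smul v t x
  let f : V →ₗ[ℝ] V →ₗ[ℝ] ℝ := LinearMap.mk₂ ℝ
    (fun x y => a (Matrix.vecCons y (Matrix.vecCons x v)))
    (fun x x' y => hadd2 x x' y) (fun t x y => hsmul2 t x y)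
    (fun x y y' => hadd y y' _) (fun t x y => hsmul t y _)
  have halt : ∀ x, f x x = 0 := fun x => a.map_eq_zero_of_eq _ (i := 0) (j := 1) rfl (by simp)
  have hswap : f Y X = -f X Y := by
    have h := halt (X + Y)
    simp only [map_add, LinearMap.add_apply, halt] at h
    linarith
  have hf : ∀ x y : V, ∑ i, ∑ j, (Module.finBasis ℝ V).repr x i * (Module.finBasis ℝ V).repr y j *
      f (Module.finBasis ℝ V i) (Module.finBasis ℝ V j) = f x y := by
    intro x y
    conv_rhs => rw [← (Module.finBasis ℝ V).sum_repr x, ← (Module.finBasis ℝ V).sum_repr y]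
    simp only [map_sum, map_smul, LinearMap.sum_apply, LinearMap.smul_apply, smul_eq_mul,
      Finset.mul_sum, mul_assoc]
    rw [Finset.sum_comm]
    refine Finset.sum_congr rfl fun i _ => Finset.sum_congr rfl fun j _ => ?_
    ring
  change (2 : ℝ)⁻¹ * ∑ i, ∑ j, Z ![dualCoord (Module.finBasis ℝ V) i,
    dualCoord (Module.finBasis ℝ V) j] * f (Module.finBasis ℝ V i) (Module.finBasis ℝ V j) = f X Y
  simp only [hZ, dualCoord_apply, sub_mul, Finset.sum_sub_distrib, hf, hswap]
  ring

theorem contraction_comp {W : Type*} [AddCommGroup W] [Module ℝ W] [TopologicalSpace W]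
    [IsTopologicalAddGroup W] [ContinuousSMul ℝ W] [T2Space W] [FiniteDimensional ℝ W]
    (φ : W ≃L[ℝ] V) (Z : (V →L[ℝ] ℝ) [⋀^Fin 2]→L[ℝ] ℝ) (Z' : (W →L[ℝ] ℝ) [⋀^Fin 2]→L[ℝ] ℝ)
    (hZ : ∀ ξ η : V →L[ℝ] ℝ, Z' ![ξ.comp φ.toContinuousLinearMap, η.comp φ.toContinuousLinearMap]
      = Z ![ξ, η]) {n : ℕ} (a : V [⋀^Fin (n + 2)]→L[ℝ] ℝ) :
    (contraction Z a).compContinuousLinearMap φ.toContinuousLinearMap =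
      contraction Z' (a.compContinuousLinearMap φ.toContinuousLinearMap) := by
  ext v
  rw [ContinuousAlternatingMap.compContinuousLinearMap_apply, contraction_apply,
    contraction_apply_basis ((Module.finBasis ℝ V).map φ.symm.toLinearEquiv)]
  have h : ∀ i, dualCoord ((Module.finBasis ℝ V).map φ.symm.toLinearEquiv) i =
      (dualCoord (Module.finBasis ℝ V) i).comp φ.toContinuousLinearMap := by
    intro i; ext w; simp
  simp only [h, hZ]
  congr 1
  refine Finset.sum_congr rfl fun i _ => Finset.sum_congr rfl fun j _ => ?_
  congr 1
  rw [ContinuousAlternatingMap.compContinuousLinearMap_apply]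
  congr 1
  funext k
  refine Fin.cases ?_ (fun k => Fin.cases ?_ (fun k => ?_) k) k <;> simp

/-- The form `F(β)` with `F(β)♯ = β♯ ∘ (id + Z♯ β♯)⁻¹`, for `id + Z♯ β♯` invertible; it is `0`
otherwise. -/
def diracForm (Z : (V →L[ℝ] ℝ) [⋀^Fin 2]→L[ℝ] ℝ) (β : V [⋀^Fin 2]→L[ℝ] ℝ) :
    V [⋀^Fin 2]→L[ℝ] ℝ :=
  let L : V →ₗ[ℝ] V →L[ℝ] ℝ := formSharp β ∘ₗ
    Ring.inverse (1 + bivectorSharp Z ∘ₗ formSharp β : Module.End ℝ V)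
  have hL : ∀ v, L v v = 0 := by
    intro v
    by_cases hu : IsUnit (1 + bivectorSharp Z ∘ₗ formSharp β : Module.End ℝ V)
    · have hv : (1 + bivectorSharp Z ∘ₗ formSharp β : Module.End ℝ V)
          (Ring.inverse (1 + bivectorSharp Z ∘ₗ formSharp β : Module.End ℝ V) v) = v :=
        LinearMap.congr_fun (Ring.mul_inverse_cancel _ hu) v
      set u := Ring.inverse (1 + bivectorSharp Z ∘ₗ formSharp β : Module.End ℝ V) v
      have alt2 : ∀ (W : Type _) [AddCommGroup W] [Module ℝ W] [TopologicalSpace W]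
          (θ : W [⋀^Fin 2]→L[ℝ] ℝ) (w : W), θ ![w, w] = 0 := fun W _ _ _ θ w =>
        θ.map_eq_zero_of_eq _ (i := 0) (j := 1) rfl (by decide)
      change formSharp β u v = 0
      rw [← hv, LinearMap.add_apply, Module.End.one_apply, LinearMap.comp_apply, map_add,
        apply_bivectorSharp, formSharp_apply, alt2, alt2, add_zero]
    · change formSharp β (Ring.inverse (1 + bivectorSharp Z ∘ₗ formSharp β : Module.End ℝ V) v) v = 0
      rw [Ring.inverse_non_unit _ hu]
      simp
  { toFun := fun v => L (v 0) (v 1)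
    map_update_add' := by
      intro _ v i x y
      fin_cases i <;> simp
    map_update_smul' := by
      intro _ v i c x
      fin_cases i <;> simp
    map_eq_zero_of_eq' := by
      intro v i j hij hne
      have h01 : v 0 = v 1 := by
        fin_cases i <;> fin_cases j <;> simp_all
      simp only [h01, hL]
    cont := by
      have h : ∀ v : Fin 2 → V, L (v 0) (v 1) = ∑ i, dualCoord (Module.finBasis ℝ V) i (v 0) *
          L (Module.finBasis ℝ V i) (v 1) := by
        intro v
        conv_lhs => rw [← (Module.finBasis ℝ V).sum_repr (v 0)]
        simp only [map_sum, map_smul, _root_.sum_apply, _root_.smul_apply, dualCoord_apply,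
          smul_eq_mul]
      change Continuous fun v : Fin 2 → V => L (v 0) (v 1)
      simp_rw [h]
      fun_prop }

theorem formSharp_diracForm (Z : (V →L[ℝ] ℝ) [⋀^Fin 2]→L[ℝ] ℝ) (β : V [⋀^Fin 2]→L[ℝ] ℝ) :
    formSharp (diracForm Z β) = formSharp β ∘ₗ
      Ring.inverse (1 + bivectorSharp Z ∘ₗ formSharp β : Module.End ℝ V) := rfl

end AltForm
end LinearAlg


noncomputable section Manifolds

section Model
namespace AltForm
variable {V : Type*} [AddCommGroup V] [Module ℝ V] [TopologicalSpace V]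

/-- The exterior product as a bilinear map. -/
def wedgeₗ (m n : ℕ) : V [⋀^Fin m]→L[ℝ] ℝ →ₗ[ℝ] V [⋀^Fin n]→L[ℝ] ℝ →ₗ[ℝ]
    V [⋀^Fin (m + n)]→L[ℝ] ℝ :=
  LinearMap.mk₂ ℝ wedge
    (by intro a a' b; ext v; simp [wedge_apply, add_mul, Finset.sum_add_distrib, mul_add])
    (by intro c a b; ext v; simp [wedge_apply, mul_assoc, Finset.mul_sum, mul_left_comm c,
      mul_smul_comm])
    (by intro a b b'; ext v; simp [wedge_apply, Finset.sum_add_distrib, mul_add])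
    (by intro c a b; ext v; simp [wedge_apply, mul_left_comm _ c, Finset.mul_sum, mul_smul_comm])

variable [IsTopologicalAddGroup V] [ContinuousSMul ℝ V] [T2Space V] [FiniteDimensional ℝ V]

/-- Contraction with a bivector as a bilinear map. -/
def contractionₗ (n : ℕ) : (V →L[ℝ] ℝ) [⋀^Fin 2]→L[ℝ] ℝ →ₗ[ℝ] V [⋀^Fin (n + 2)]→L[ℝ] ℝ →ₗ[ℝ]
    V [⋀^Fin n]→L[ℝ] ℝ :=
  LinearMap.mk₂ ℝ (fun Z a => contraction Z a)
    (by intro a a' b; ext v; simp [contraction_apply, add_mul, Finset.sum_add_distrib, mul_add])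
    (by intro c a b; ext v; simp [contraction_apply, mul_assoc, Finset.mul_sum, mul_left_comm c])
    (by intro a b b'; ext v; simp [contraction_apply, Finset.sum_add_distrib, mul_add])
    (by intro c a b; ext v; simp [contraction_apply, mul_left_comm _ c, Finset.mul_sum])

end AltForm

variable {E : Type*} [NormedAddCommGroup E] [NormedSpace ℝ E] [FiniteDimensional ℝ E]

instance AltForm.finiteDimensional (n : ℕ) : FiniteDimensional ℝ (E [⋀^Fin n]→L[ℝ] ℝ) := by
  let f : E [⋀^Fin n]→L[ℝ] ℝ →ₗ[ℝ] MultilinearMap ℝ (fun _ : Fin n => E) ℝ :=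
    { toFun := fun a => a.toMultilinearMap
      map_add' := fun _ _ => rfl
      map_smul' := fun _ _ => rfl }
  exact FiniteDimensional.of_injective f fun a b h => by
    ext v
    exact congrArg (fun g : MultilinearMap ℝ (fun _ : Fin n => E) ℝ => g v) h

end Model

variable (E : Type*) [NormedAddCommGroup E] [NormedSpace ℝ E]
  (M : Type*) [TopologicalSpace M] [ChartedSpace E M] [IsManifold 𝓘(ℝ, E) ∞ M]

/-- The fibre `⋀ⁿ T*ₓM`. -/
abbrev AltFiber (n : ℕ) (x : M) : Type _ := TangentSpace 𝓘(ℝ, E) x [⋀^Fin n]→L[ℝ] Trivial M ℝ x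

/-- Smooth differential forms of degree `n`: smooth sections of `⋀ⁿ T*M`. -/
abbrev DForm (n : ℕ) : Type _ := Cₛ^∞⟮𝓘(ℝ, E); E [⋀^Fin n]→L[ℝ] ℝ, AltFiber E M n⟯

/-- The fibre `T*ₓM`. -/
abbrev CotFiber (x : M) : Type _ := TangentSpace 𝓘(ℝ, E) x →L[ℝ] Trivial M ℝ x

/-- The fibre `⋀² TₓM`, realised as the alternating bilinear forms on `T*ₓM`. -/
abbrev BivFiber (x : M) : Type _ := CotFiber E M x [⋀^Fin 2]→L[ℝ] Trivial M ℝ x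

/-- Smooth bivector fields. -/
abbrev Bivector : Type _ := Cₛ^∞⟮𝓘(ℝ, E); (E →L[ℝ] ℝ) [⋀^Fin 2]→L[ℝ] ℝ, BivFiber E M⟯

variable {E M}

instance [FiniteDimensional ℝ E] (x : M) : FiniteDimensional ℝ (TangentSpace 𝓘(ℝ, E) x) :=
  inferInstanceAs (FiniteDimensional ℝ E)

instance (x : M) : T2Space (TangentSpace 𝓘(ℝ, E) x) := inferInstanceAs (T2Space E)

/-- A differential form in the trivialisation of `⋀ⁿ T*M` over the chart at `x₀`. -/
def localForm {n : ℕ} (x₀ : M) (a : ∀ x, AltFiber E M n x) (x : M) : E [⋀^Fin n]→L[ℝ] ℝ :=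
  (trivializationAt (E [⋀^Fin n]→L[ℝ] ℝ) (AltFiber E M n) x₀ ⟨x, a x⟩).2

theorem localForm_eq {n : ℕ} (x₀ : M) (a : ∀ x, AltFiber E M n x) (x : M) : localForm x₀ a x =
    (a x).compContinuousLinearMap
      ((trivializationAt E (TangentSpace 𝓘(ℝ, E)) x₀).symmL ℝ x) := by
  change ContinuousAlternatingMap.inCoordinates E ℝ x₀ x x₀ x (a x) = _
  ext v
  simp [ContinuousAlternatingMap.inCoordinates, Function.comp_def]

/-- A bivector field in the trivialisation over the chart at `x₀`. -/
def localBiv (x₀ : M) (Z : ∀ x, BivFiber E M x) (x : M) : (E →L[ℝ] ℝ) [⋀^Fin 2]→L[ℝ] ℝ :=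
  (trivializationAt ((E →L[ℝ] ℝ) [⋀^Fin 2]→L[ℝ] ℝ) (BivFiber E M) x₀ ⟨x, Z x⟩).2

theorem localBiv_apply (x₀ : M) (Z : ∀ x, BivFiber E M x) (x : M)
    (hx : x ∈ (trivializationAt E (TangentSpace 𝓘(ℝ, E)) x₀).baseSet) (ξ η : CotFiber E M x) :
    localBiv x₀ Z x ![ξ.comp ((trivializationAt E (TangentSpace 𝓘(ℝ, E)) x₀).symmL ℝ x),
      η.comp ((trivializationAt E (TangentSpace 𝓘(ℝ, E)) x₀).symmL ℝ x)] = Z x ![ξ, η] := by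
  change ContinuousAlternatingMap.inCoordinates (E →L[ℝ] ℝ) ℝ x₀ x x₀ x (Z x) _ = _
  have hsymm : ∀ ζ : CotFiber E M x,
      (trivializationAt (E →L[ℝ] ℝ) (CotFiber E M) x₀).symmL ℝ x
        (ζ.comp ((trivializationAt E (TangentSpace 𝓘(ℝ, E)) x₀).symmL ℝ x)) = ζ := by
    intro ζ
    have hx' : x ∈ (trivializationAt (E →L[ℝ] ℝ) (CotFiber E M) x₀).baseSet := ⟨hx, trivial⟩
    have h := (trivializationAt (E →L[ℝ] ℝ) (CotFiber E M) x₀).symmL_continuousLinearMapAt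
      (R := ℝ) hx' ζ
    rw [Trivialization.continuousLinearMapAt_apply,
      Trivialization.linearMapAt_apply, if_pos hx', hom_trivializationAt_apply] at h
    convert h using 2
    ext v
    simp [ContinuousLinearMap.inCoordinates]
  simp only [ContinuousAlternatingMap.inCoordinates,
    ContinuousAlternatingMap.compContinuousLinearMap_apply]
  have hv : (⇑(Trivialization.symmL ℝ (trivializationAt (E →L[ℝ] ℝ) (CotFiber E M) x₀) x) ∘
        ![ξ.comp ((trivializationAt E (TangentSpace 𝓘(ℝ, E)) x₀).symmL ℝ x),
          η.comp ((trivializationAt E (TangentSpace 𝓘(ℝ, E)) x₀).symmL ℝ x)]) = ![ξ, η] := by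
    funext i
    fin_cases i
    · exact hsymm ξ
    · exact hsymm η
  simp
  rw [hv]

theorem contMDiff_iff_localForm {n : ℕ} (a : ∀ x, AltFiber E M n x) :
    ContMDiff 𝓘(ℝ, E) (𝓘(ℝ, E).prod 𝓘(ℝ, E [⋀^Fin n]→L[ℝ] ℝ)) ∞
      (fun x => TotalSpace.mk' (E [⋀^Fin n]→L[ℝ] ℝ) x (a x)) ↔
    ∀ x₀, ContMDiffAt 𝓘(ℝ, E) 𝓘(ℝ, E [⋀^Fin n]→L[ℝ] ℝ) ∞ (localForm x₀ a) x₀ :=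
  forall_congr' fun x₀ => contMDiffAt_section x₀

theorem contMDiffAt_localBiv (Z : Bivector E M) (x₀ : M) :
    ContMDiffAt 𝓘(ℝ, E) 𝓘(ℝ, (E →L[ℝ] ℝ) [⋀^Fin 2]→L[ℝ] ℝ) ∞ (localBiv x₀ Z) x₀ :=
  (contMDiffAt_section x₀).1 (Z.contMDiff x₀)

open AltForm
variable [FiniteDimensional ℝ E]

/-- The exterior product of differential forms. -/
def wedgeForm {m n : ℕ} (a : DForm E M m) (b : DForm E M n) : DForm E M (m + n) where
  toFun x := wedge (a x) (b x)
  contMDiff_toFun := by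
    refine (contMDiff_iff_localForm _).2 fun x₀ => ?_
    have ha := (contMDiff_iff_localForm _).1 a.contMDiff x₀
    have hb := (contMDiff_iff_localForm _).1 b.contMDiff x₀
    have h : localForm x₀ (fun x => wedge (a x) (b x)) = fun x =>
        (LinearMap.toContinuousBilinearMap (wedgeₗ m n)) (localForm x₀ a x) (localForm x₀ b x) := by
      funext x
      rw [localForm_eq, localForm_eq, localForm_eq]
      exact wedge_comp _ _ _
    rw [h]
    exact (contMDiffAt_const.clm_apply ha).clm_apply hb

/-- The contraction `ι_Z`. -/
def contractForm (Z : Bivector E M) {n : ℕ} (a : DForm E M (n + 2)) : DForm E M n where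
  toFun x := contraction (Z x) (a x)
  contMDiff_toFun := by
    refine (contMDiff_iff_localForm _).2 fun x₀ => ?_
    have ha := (contMDiff_iff_localForm _).1 a.contMDiff x₀
    have hZ := contMDiffAt_localBiv Z x₀
    have h : localForm x₀ (fun x => contraction (Z x) (a x)) =ᶠ[nhds x₀] fun x =>
        (LinearMap.toContinuousBilinearMap (contractionₗ (V := E) n)) (localBiv x₀ Z x)
          (localForm x₀ a x) := by
      filter_upwards [(trivializationAt E (TangentSpace 𝓘(ℝ, E)) x₀).open_baseSet.mem_nhds
        (FiberBundle.mem_baseSet_trivializationAt E (TangentSpace 𝓘(ℝ, E)) x₀)] with x hx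
      rw [localForm_eq, localForm_eq]
      set φ := ((trivializationAt E (TangentSpace 𝓘(ℝ, E)) x₀).continuousLinearEquivAt ℝ x hx).symm
      have hφ : (trivializationAt E (TangentSpace 𝓘(ℝ, E)) x₀).symmL ℝ x =
          φ.toContinuousLinearMap := by
        ext v
        exact congrFun (Trivialization.symm_continuousLinearEquivAt_eq _ hx).symm v
      have hZ' := localBiv_apply x₀ Z x hx
      rw [hφ] at hZ' ⊢
      exact contraction_comp φ (Z x) (localBiv x₀ Z x) hZ' (a x)
    exact ((contMDiffAt_const.clm_apply hZ).clm_apply ha).congr_of_eventuallyEq h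


@[simp]
theorem wedgeForm_apply {m n : ℕ} (a : DForm E M m) (b : DForm E M n) (x : M) :
    wedgeForm a b x = wedge (a x) (b x) := rfl

@[simp]
theorem contractForm_apply (Z : Bivector E M) {n : ℕ} (a : DForm E M (n + 2)) (x : M) :
    contractForm Z a x = contraction (Z x) (a x) := rfl

variable (E M) in
/-- The graded vector space `Ω(M) = ⨁ₙ Ωⁿ(M)`. -/
abbrev Forms : Type _ := ⨁ n, DForm E M n

variable (E M) in
/-- The inclusion of the forms of degree `n`. -/
abbrev homForm (n : ℕ) : DForm E M n →ₗ[ℝ] Forms E M := DirectSum.lof ℝ ℕ (DForm E M) n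

variable (E M) in
/-- The exterior product `Ωᵐ(M) × Ωⁿ(M) → Ωᵐ⁺ⁿ(M)`, as a bilinear map. -/
def wedgeFormₗ (m n : ℕ) : DForm E M m →ₗ[ℝ] DForm E M n →ₗ[ℝ] DForm E M (m + n) :=
  LinearMap.mk₂ ℝ wedgeForm
    (fun a a' b => by ext1 x; exact LinearMap.map_add₂ (wedgeₗ m n) (a x) (a' x) (b x))
    (fun c a b => by ext1 x; exact LinearMap.map_smul₂ (wedgeₗ m n) c (a x) (b x))
    (fun a b b' => by ext1 x; exact map_add (wedgeₗ m n (a x)) (b x) (b' x))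
    (fun c a b => by ext1 x; exact map_smul (wedgeₗ m n (a x)) c (b x))

/-- The contraction `ι_Z : Ωⁿ⁺²(M) → Ωⁿ(M)`, as a linear map. -/
def contractFormₗ (Z : Bivector E M) (n : ℕ) : DForm E M (n + 2) →ₗ[ℝ] DForm E M n where
  toFun a := contractForm Z a
  map_add' a b := by ext1 x; exact map_add (contractionₗ n (Z x)) (a x) (b x)
  map_smul' c a := by ext1 x; exact map_smul (contractionₗ n (Z x)) c (a x)

theorem homForm_congr {p q : ℕ} (h : p = q) (a : DForm E M p) (b : DForm E M q)
    (hab : ∀ x v, b x v = a x (v ∘ finCongr h)) : homForm E M p a = homForm E M q b := by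
  subst h
  congr 1
  ext1 x
  ext v
  exact (hab x v).symm

theorem wedge_gradedComm (m n : ℕ) (a : DForm E M m) (b : DForm E M n) :
    totalMul (wedgeFormₗ E M) (homForm E M m a) (homForm E M n b) =
      (-1 : ℝ) ^ (m * n) • totalMul (wedgeFormₗ E M) (homForm E M n b) (homForm E M m a) := by
  rw [totalMul_lof, totalMul_lof, ← map_smul]
  symm
  refine homForm_congr (add_comm n m) _ _ fun x v => ?_
  exact wedge_comm (a x) (b x) v

/-- `(a, b) ↦ ι_Z (a ∧ b) - ι_Z a ∧ b - a ∧ ι_Z b`. -/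
def koszulBracket (Z : Bivector E M) : Forms E M →ₗ[ℝ] Forms E M →ₗ[ℝ] Forms E M :=
  derivationDefect (wedgeFormₗ E M) (contractFormₗ Z)

theorem koszulBracket_isKoszulSymmetric (Z : Bivector E M) :
    IsKoszulSymmetric (koszulBracket Z) :=
  derivationDefect_isKoszulSymmetric _ _ wedge_gradedComm

/-- The coderivation `R_Z` of `⨀ (Ω(M)[2])` with quadratic Taylor coefficient `koszulBracket Z`. -/
def koszulCoder (Z : Bivector E M) : Module.End ℝ (GSym (DForm E M)) :=
  GSym.coder (koszulBracket Z) (koszulBracket_isKoszulSymmetric Z)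

/-- The coalgebra automorphism `ψ = exp R_Z` of `⨀ (Ω(M)[2])`. -/
def koszulExp (Z : Bivector E M) : Module.End ℝ (GSym (DForm E M)) :=
  GSym.locExp (koszulCoder Z)
    (GSym.coder_locallyNilpotent (koszulBracket Z) (koszulBracket_isKoszulSymmetric Z))

/-- The Taylor coefficients `ψₖ : ⨀ᵏ (Ω(M)[2]) → Ω(M)[2]` of `ψ`. -/
def psiCoeff (Z : Bivector E M) (k : ℕ) (x : Fin k → Forms E M) : Forms E M :=
  GSym.taylor (koszulExp Z) k x

/-- The 2-form `1/k! ψₖ(β ⊙ ⋯ ⊙ β)`: the degree 2 component of this element of `Ω(M)`. -/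
def psiTerm (Z : Bivector E M) (β : DForm E M 2) (k : ℕ) : DForm E M 2 :=
  ((k.factorial : ℝ)⁻¹) • (psiCoeff Z k fun _ => homForm E M 2 β) 2

/-- The set `I_Z ⊆ ⋀² T*M` of all `β` for which `id + Z♯ β♯` is invertible. -/
def invertibleLocus (Z : Bivector E M) :
    Set (TotalSpace (E [⋀^Fin 2]→L[ℝ] ℝ) (AltFiber E M 2)) :=
  {p | IsUnit (1 + bivectorSharp (Z p.1) ∘ₗ formSharp p.2 :
    Module.End ℝ (TangentSpace 𝓘(ℝ, E) p.1))}

variable (E M) in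
/-- The `C^∞` topology on `Ωⁿ(M)`: uniform convergence of all derivatives, in the charts of `M`, on
compact subsets of the chart domains. -/
abbrev cInfTopology (n : ℕ) : TopologicalSpace (DForm E M n) :=
  ⨅ (x₀ : M) (r : ℕ), TopologicalSpace.induced
    (fun a => UniformOnFun.ofFun {K : Set E | IsCompact K ∧ K ⊆ (chartAt E x₀).target}
      (iteratedFDeriv ℝ r (fun y => localForm x₀ a ((chartAt E x₀).symm y)))) inferInstance

end Manifolds

/-!
The quadratic Taylor coefficient `K` of `R_Z`, evaluated on 2-forms `a` and `b`, is the 2-form with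
`K(a, b)♯ = -(a♯ Z♯ b♯ + b♯ Z♯ a♯)` (`AltForm.contraction_wedge_two_two`). Hence the 2-forms `γⱼ` with
`γⱼ♯ = (-1)ʲ β♯ (Z♯ β♯)ʲ` satisfy `K(γᵢ, γⱼ) = 2 γᵢ₊ⱼ₊₁`, and `R_Z` maps a word of `n` letters
`γ_{l₁} ⊙ ⋯ ⊙ γ_{lₙ}` of weight `s = l₁ + ⋯ + lₙ` to a sum of `n (n - 1) / 2` such words with `n - 1`
letters and weight `s + 1`, each with coefficient `2`. After `n` steps the word `γ₀ ⊙ ⋯ ⊙ γ₀` of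
length `n + 1` becomes `(n + 1)! n! γₙ`, and no other power of `R_Z` contributes to `ψₙ₊₁`, so that
`ψₙ₊₁(β, …, β) = (n + 1)! γₙ` (`GSym.taylor_locExp_coder`). The series `ψ_*(β)` is therefore the
geometric series `∑ⱼ (-1)ʲ β♯ (Z♯ β♯)ʲ`.

For the convergence, `U` is the set of all `b` for which `Z♯ b♯` is conjugate to an endomorphism of
norm less than one. This condition does not involve a chart, and it is open because it can be tested
in a local trivialisation (`isOpen_smallLocus`). In a chart, the remainder of the series is
`β♯ (-A)ᴺ (1 + A)⁻¹` with `A = Z♯ β♯` (`localForm_remainder`). The norms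
`∑_{k ≤ r} εᵏ / k! ‖Dᵏ f(y)‖` of `r`-jets are submultiplicative by the Leibniz rule
(`jetNorm_mul_le`), and if `‖f(y₀)‖ < 1`, then the norm of the jet of `f` is less than one near `y₀`
once `ε` is small. So all derivatives of `fᴺ` decay geometrically near `y₀`; this applies to a
conjugate of `-A` and gives convergence in the `C^∞` topology (`tendsto_sum_psiTerm`).
-/

/-! ### Words in the graded symmetric coalgebra -/

noncomputable section WeightedMonomials
namespace GSym

variable {A : ℕ → Type*} [∀ n, AddCommGroup (A n)] [∀ n, Module ℝ (A n)] {d : ℕ} (γ : ℕ → A d)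

/-- The product `γ_{l₁} ⊙ ⋯ ⊙ γ_{lₙ}` in `⨀ V` for a list `l = [l₁, …, lₙ]`. -/
def monomial (l : List ℕ) : GSym A := (l.map fun i => ι (DirectSum.lof ℝ ℕ A d (γ i))).prod

/-- Pairs `(w, c)` such that `w` is a linear combination, with sum of coefficients `c`, of monomials
of length `n` and weight `l₁ + ⋯ + lₙ = s`. -/
def weighted (n s : ℕ) : Submodule ℝ (GSym A × ℝ) :=
  Submodule.span ℝ {p | ∃ l : List ℕ, l.length = n ∧ l.sum = s ∧ p = (monomial γ l, 1)}

variable {γ}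

/-- A map that takes each monomial of length `n` and weight `s` to a combination of monomials of
length `n'` and weight `s'` with sum of coefficients `c` multiplies sums of coefficients by `c`. -/
theorem map_mem_weighted {n s n' s' : ℕ} {c : ℝ} (f : GSym A →ₗ[ℝ] GSym A)
    (hf : ∀ l : List ℕ, l.length = n → l.sum = s → (f (monomial γ l), c) ∈ weighted γ n' s')
    {p : GSym A × ℝ} (hp : p ∈ weighted γ n s) : (f p.1, c * p.2) ∈ weighted γ n' s' := by
  have h : weighted γ n s ≤ (weighted γ n' s').comap
      ((f ∘ₗ LinearMap.fst ℝ _ _).prod (c • LinearMap.snd ℝ _ _)) := by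
    refine Submodule.span_le.2 ?_
    rintro _ ⟨l, hl, hs, rfl⟩
    simpa using hf l hl hs
  exact h hp

theorem monomial_mem (l : List ℕ) : (monomial γ l, (1 : ℝ)) ∈ weighted γ l.length l.sum :=
  Submodule.subset_span ⟨l, rfl, rfl, rfl⟩

theorem monomial_cons (i : ℕ) (l : List ℕ) :
    monomial γ (i :: l) = ι (DirectSum.lof ℝ ℕ A d (γ i)) * monomial γ l := rfl

theorem ι_mul_mem {n s : ℕ} (i : ℕ) {w : GSym A} {c : ℝ} (hp : (w, c) ∈ weighted γ n s) :
    (ι (DirectSum.lof ℝ ℕ A d (γ i)) * w, c) ∈ weighted γ (n + 1) (i + s) := by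
  have := map_mem_weighted (γ := γ) (n' := n + 1) (s' := i + s) (c := 1)
    (LinearMap.mulLeft ℝ (ι (DirectSum.lof ℝ ℕ A d (γ i)))) ?_ hp
  · simpa using this
  · rintro l rfl rfl
    exact monomial_mem (i :: l)

variable {K : (⨁ n, A n) →ₗ[ℝ] (⨁ n, A n) →ₗ[ℝ] ⨁ n, A n} (hK : IsKoszulSymmetric K)

section
variable (hd : Even d) (hγ : ∀ i j, K (DirectSum.lof ℝ ℕ A d (γ i)) (DirectSum.lof ℝ ℕ A d (γ j)) =
  (2 : ℝ) • DirectSum.lof ℝ ℕ A d (γ (i + j + 1)))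
include hd hγ

/-- Contracting a word of length `n` with `γᵢ` gives `n` words, each with coefficient `2`. -/
theorem contr_monomial_mem (i : ℕ) (l : List ℕ) :
    (contr K hK (monomial γ l) (DirectSum.lof ℝ ℕ A d (γ i)), 2 * (l.length : ℝ)) ∈
      weighted γ l.length (l.sum + i + 1) := by
  induction l with
  | nil =>
    have h : (contr K hK (monomial γ []) (DirectSum.lof ℝ ℕ A d (γ i)),
        2 * (([] : List ℕ).length : ℝ)) = 0 := by simp [monomial, contr_one]
    rw [h]
    exact zero_mem _
  | cons j l ih =>
    rw [monomial_cons, contr_mul, twist_lof, (hd.mul_right d).neg_one_pow, one_smul, hγ, map_smul,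
      smul_mul_assoc]
    have h1 := ι_mul_mem j ih
    have h2 := Submodule.smul_mem _ (2 : ℝ) (monomial_mem (γ := γ) ((i + j + 1) :: l))
    have e1 : j + (l.sum + i + 1) = (j :: l).sum + i + 1 := by simp; ring
    have e2 : ((i + j + 1) :: l).sum = (j :: l).sum + i + 1 := by simp; ring
    rw [e1] at h1
    rw [e2] at h2
    convert add_mem h1 h2 using 1
    · rfl
    refine Prod.ext rfl ?_
    simp only [List.length_cons, Nat.cast_add, Nat.cast_one, Prod.snd_add, Prod.smul_snd,
      smul_eq_mul]
    ring

/-- The coderivation merges each of the `n (n - 1) / 2` pairs of letters of a word of length `n` and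
produces a factor `2`. -/
theorem coder_monomial_mem (l : List ℕ) :
    (coder K hK (monomial γ l), (l.length : ℝ) * (l.length - 1)) ∈
      weighted γ (l.length - 1) (l.sum + 1) := by
  induction l with
  | nil =>
    have h : (coder K hK (monomial γ []),
        (([] : List ℕ).length : ℝ) * (([] : List ℕ).length - 1)) = 0 := by
      simp [monomial, coder_one]
    rw [h]
    exact zero_mem _
  | cons j l ih =>
    rw [monomial_cons, coder_mul]
    have h2 := contr_monomial_mem hK hd hγ j l
    cases l with
    | nil =>
      have h : (ι (DirectSum.lof ℝ ℕ A d (γ j)) * coder K hK (monomial γ []) +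
          contr K hK (monomial γ []) (DirectSum.lof ℝ ℕ A d (γ j)),
          (([j] : List ℕ).length : ℝ) * (([j] : List ℕ).length - 1)) = 0 := by
        simp [monomial, coder_one, contr_one]
      rw [h]
      exact zero_mem _
    | cons k l =>
      have h1 := ι_mul_mem j ih
      have e1 : j + ((k :: l).sum + 1) = (j :: k :: l).sum + 1 := by simp; ring
      have e2 : (k :: l).sum + j + 1 = (j :: k :: l).sum + 1 := by simp; ring
      rw [e1] at h1
      rw [e2] at h2
      convert add_mem h1 h2 using 1
      · rfl
      refine Prod.ext rfl ?_
      simp only [List.length_cons, Nat.cast_add, Nat.cast_one, Prod.snd_add]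
      ring

/-- The factors `k (k - 1)` for `n + 1 < k ≤ n + 1 + j` multiply to
`(n + 1 + j)! (n + j)! / ((n + 1)! n!)`. -/
theorem coder_pow_mem (n s j : ℕ) {w : GSym A} {c : ℝ} (h : (w, c) ∈ weighted γ (n + 1 + j) s) :
    ((coder K hK ^ j) w, c * (((n + 1 + j).factorial : ℝ) * (n + j).factorial) /
      ((n + 1).factorial * n.factorial)) ∈ weighted γ (n + 1) (s + j) := by
  induction j generalizing w c s with
  | zero =>
    have h0 : c * (((n + 1).factorial : ℝ) * n.factorial) / ((n + 1).factorial * n.factorial) = c :=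
      mul_div_cancel_right₀ _ (by positivity)
    simpa only [add_zero, h0, pow_zero, Module.End.one_apply] using h
  | succ j ih =>
    have h1 := map_mem_weighted (γ := γ) (n := n + 1 + (j + 1)) (s := s) (n' := n + 1 + j)
      (s' := s + 1) (c := ((n + 1 + j + 1 : ℕ) : ℝ) * ((n + 1 + j : ℕ))) (coder K hK) ?_ h
    · have h2 := ih (s + 1) h1
      rw [pow_succ, Module.End.mul_apply]
      rw [show s + (j + 1) = s + 1 + j by ring]
      convert h2 using 2
      rw [show n + 1 + (j + 1) = (n + 1 + j) + 1 by ring, ← add_assoc n j 1,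
        Nat.factorial_succ (n + 1 + j), Nat.factorial_succ (n + j)]
      push_cast
      ring
    · intro l hl hs
      have := coder_monomial_mem hK hd hγ l
      rw [hl, hs, show n + 1 + (j + 1) - 1 = n + 1 + j by omega] at this
      convert this using 2
      push_cast
      ring

end

theorem proj_of_mem_weighted_one {s : ℕ} {w : GSym A} {c : ℝ} (h : (w, c) ∈ weighted γ 1 s) :
    proj w = c • DirectSum.lof ℝ ℕ A d (γ s) := by
  have hle : weighted γ 1 s ≤ LinearMap.ker (proj ∘ₗ LinearMap.fst ℝ (GSym A) ℝ -
      (LinearMap.snd ℝ (GSym A) ℝ).smulRight (DirectSum.lof ℝ ℕ A d (γ s))) := by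
    refine Submodule.span_le.2 ?_
    rintro _ ⟨l, hl, hs, rfl⟩
    obtain ⟨i, rfl⟩ := List.length_eq_one_iff.1 hl
    simp only [List.sum_singleton] at hs
    subst hs
    simp [monomial, proj_ι]
  simpa [sub_eq_zero] using hle h

theorem monomial_mem_range_pow (l : List ℕ) :
    monomial γ l ∈ LinearMap.range (ι (A := A)) ^ l.length := by
  induction l with
  | nil => rw [List.length_nil, pow_zero]; exact Submodule.one_le.1 le_rfl
  | cons i l ih =>
    rw [List.length_cons, pow_succ', monomial_cons]
    exact Submodule.mul_mem_mul (ι_mem _) ih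

theorem coder_pow_mem_range_pow (m : ℕ) : ∀ (j : ℕ), ∀ w ∈ LinearMap.range (ι (A := A)) ^ (m + j),
    (coder K hK ^ j) w ∈ LinearMap.range (ι (A := A)) ^ m := by
  intro j
  induction j with
  | zero => intro w hw; simpa using hw
  | succ j ih =>
    intro w hw
    rw [pow_succ, Module.End.mul_apply]
    exact ih _ (coder_mem K hK (m + j) w hw)

/-- Only the power `Rⁿ` contributes to the Taylor coefficient of `exp R` on words of length
`n + 1`. -/
theorem proj_locExp_coder (n : ℕ) (w : GSym A) (hw : w ∈ LinearMap.range (ι (A := A)) ^ (n + 1)) :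
    proj (locExp (coder K hK) (coder_locallyNilpotent K hK) w) =
      ((n.factorial : ℝ)⁻¹) • proj ((coder K hK ^ n) w) := by
  have hz : ∀ j, n + 1 < j → (coder K hK ^ j) w = 0 := fun j hj =>
    pow_apply_eq_zero (coder_pow_eq_zero K hK (n + 1) w hw) hj
  have h : locExp (coder K hK) (coder_locallyNilpotent K hK) w =
      ∑ j ∈ Finset.range (n + 2), ((j.factorial : ℝ)⁻¹) • (coder K hK ^ j) w := by
    change ∑ᶠ j : ℕ, ((j.factorial : ℝ)⁻¹) • (coder K hK ^ j) w = _
    refine finsum_eq_sum_of_support_subset _ fun j hj => ?_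
    rw [Finset.coe_range, Set.mem_Iio]
    by_contra hle
    exact hj (by simp [hz j (by omega)])
  rw [h, map_sum, Finset.sum_eq_single n]
  · rw [map_smul]
  · intro j hj hne
    rw [map_smul]
    rcases lt_or_gt_of_ne hne with hlt | hgt
    · obtain ⟨m, rfl⟩ : ∃ m, n = m + 1 + j := ⟨n - 1 - j, by omega⟩
      rw [proj_eq_zero m _ (coder_pow_mem_range_pow hK (m + 2) j w (by convert hw using 2; ring)),
        smul_zero]
    · obtain rfl : j = n + 1 := by have := Finset.mem_range.1 hj; omega
      have := coder_pow_mem_range_pow hK 0 (n + 1) w (by rwa [zero_add])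
      rw [pow_zero] at this
      obtain ⟨c, hc⟩ := Submodule.mem_one.1 this
      rw [← hc, Algebra.algebraMap_eq_smul_one, map_smul, proj_one, smul_zero, smul_zero]
  · intro h; simp at h

/-- If `K(γᵢ, γⱼ) = 2 γᵢ₊ⱼ₊₁`, then the Taylor coefficients of the exponential of the coderivation
defined by `K` satisfy `ψₙ₊₁(γ₀, …, γ₀) = (n + 1)! γₙ`. -/
theorem taylor_locExp_coder (hd : Even d)
    (hγ : ∀ i j, K (DirectSum.lof ℝ ℕ A d (γ i)) (DirectSum.lof ℝ ℕ A d (γ j)) =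
      (2 : ℝ) • DirectSum.lof ℝ ℕ A d (γ (i + j + 1))) (n : ℕ) :
    taylor (locExp (coder K hK) (coder_locallyNilpotent K hK)) (n + 1)
      (fun _ => DirectSum.lof ℝ ℕ A d (γ 0)) =
      ((n + 1).factorial : ℝ) • DirectSum.lof ℝ ℕ A d (γ n) := by
  have hm : (List.ofFn fun _ : Fin (n + 1) => ι (DirectSum.lof ℝ ℕ A d (γ 0))).prod =
      monomial γ (List.replicate (n + 1) 0) := by
    rw [monomial, List.map_replicate, List.ofFn_const]
  have h1 := monomial_mem (γ := γ) (List.replicate (n + 1) 0)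
  have h2 := monomial_mem_range_pow (γ := γ) (List.replicate (n + 1) 0)
  simp only [List.length_replicate, List.sum_replicate, smul_zero] at h1 h2
  rw [taylor, hm, proj_locExp_coder hK n _ h2]
  have h3 := coder_pow_mem hK hd hγ 0 0 n (w := monomial γ (List.replicate (n + 1) 0)) (c := 1)
    (by convert h1 using 2; ring)
  rw [proj_of_mem_weighted_one h3, smul_smul]
  simp only [zero_add, add_comm 1 n]
  congr 1
  simp only [one_mul, Nat.factorial_one, Nat.factorial_zero, Nat.cast_one, div_one]
  field_simp

end GSym
end WeightedMonomials

/-! ### The bracket of two 2-forms -/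

noncomputable section BracketOfTwoForms
namespace AltForm
variable {V : Type*} [AddCommGroup V] [Module ℝ V] [TopologicalSpace V]

theorem apply_swap (a : V [⋀^Fin 2]→L[ℝ] ℝ) (x y : V) : a ![x, y] = -a ![y, x] := by
  have h := a.toAlternatingMap.map_swap ![y, x] (i := 0) (j := 1) (by decide)
  have e : ![y, x] ∘ Equiv.swap (0 : Fin 2) 1 = ![x, y] := by
    funext i; fin_cases i <;> simp
  rw [e] at h
  exact h

theorem wedge_two_two (a b : V [⋀^Fin 2]→L[ℝ] ℝ) (x y v w : V) :
    wedge a b ![x, y, v, w] = a ![x, y] * b ![v, w] - a ![x, v] * b ![y, w] +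
      a ![x, w] * b ![y, v] + a ![y, v] * b ![x, w] - a ![y, w] * b ![x, v] +
      a ![v, w] * b ![x, y] := by
  have key : ∀ σ : Equiv.Perm (Fin (2 + 2)),
      a (![x, y, v, w] ∘ σ ∘ Fin.castAdd 2) * b (![x, y, v, w] ∘ σ ∘ Fin.natAdd 2) =
      a ![(![x, y, v, w] : Fin 4 → V) (σ 0), (![x, y, v, w] : Fin 4 → V) (σ 1)] *
        b ![(![x, y, v, w] : Fin 4 → V) (σ 2), (![x, y, v, w] : Fin 4 → V) (σ 3)] := by
    intro σ
    congr 2 <;> funext i <;> fin_cases i <;> rfl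
  have two : ∀ {n : ℕ} (p : Fin (n + 3)) (e : Equiv.Perm (Fin (n + 2))),
      Equiv.Perm.decomposeFin.symm (p, e) 2 = Equiv.swap 0 p (e 1).succ :=
    fun p e => Equiv.Perm.decomposeFin_symm_apply_succ e p 1
  have three : ∀ (p : Fin 4) (e : Equiv.Perm (Fin 3)),
      Equiv.Perm.decomposeFin.symm (p, e) 3 = Equiv.swap 0 p (e 2).succ :=
    fun p e => Equiv.Perm.decomposeFin_symm_apply_succ e p 2
  rw [wedge_apply]
  simp only [key]
  change _ * ∑ σ : Equiv.Perm (Fin 4), _ = _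
  simp only [Finset.univ_perm_fin_succ, Finset.sum_map, Equiv.toEmbedding_apply,
    Fintype.sum_prod_type, Fin.sum_univ_succ, Finset.univ_unique, Finset.sum_singleton]
  simp [two, three, Equiv.swap_apply_def]
  rw [apply_swap a y x, apply_swap a v x, apply_swap a w x, apply_swap a v y, apply_swap a w y,
    apply_swap a w v, apply_swap b y x, apply_swap b v x, apply_swap b w x, apply_swap b v y,
    apply_swap b w y, apply_swap b w v]
  ring

theorem wedge_zero_left (f : V [⋀^Fin 0]→L[ℝ] ℝ) (b : V [⋀^Fin 2]→L[ℝ] ℝ) (v w : V) :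
    wedge f b ![v, w] = f ![] * b ![v, w] := by
  have key : ∀ σ : Equiv.Perm (Fin (0 + 2)),
      f ((![v, w] : Fin (0 + 2) → V) ∘ σ ∘ Fin.castAdd 2) *
        b ((![v, w] : Fin (0 + 2) → V) ∘ σ ∘ Fin.natAdd 0) =
      f ![] * b ![(![v, w] : Fin 2 → V) (σ 0), (![v, w] : Fin 2 → V) (σ 1)] := by
    intro σ
    congr 2
    · exact Subsingleton.elim _ _
    · funext i; fin_cases i <;> rfl
  rw [wedge_apply]
  simp only [key]
  change _ * ∑ σ : Equiv.Perm (Fin 2), _ = _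
  simp only [Finset.univ_perm_fin_succ, Finset.sum_map, Equiv.toEmbedding_apply,
    Fintype.sum_prod_type, Fin.sum_univ_succ, Finset.univ_unique, Finset.sum_singleton]
  simp
  rw [apply_swap b w v]
  ring

theorem wedge_zero_right (f : V [⋀^Fin 0]→L[ℝ] ℝ) (b : V [⋀^Fin 2]→L[ℝ] ℝ) (v w : V) :
    wedge b f ![v, w] = b ![v, w] * f ![] := by
  have h := wedge_comm b f ![v, w]
  simp only [mul_zero, pow_zero, one_mul] at h
  rw [h, mul_comm, ← wedge_zero_left f b v w]
  congr 1

variable [IsTopologicalAddGroup V] [ContinuousSMul ℝ V] [T2Space V] [FiniteDimensional ℝ V]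

/-- For 2-forms `a` and `b`, the contraction of `a ∧ b` with `Z` differs from
`(ι_Z a) b + (ι_Z b) a` by the 2-form with sharp map `-(a♯ Z♯ b♯ + b♯ Z♯ a♯)`. -/
theorem contraction_wedge_two_two (Z : (V →L[ℝ] ℝ) [⋀^Fin 2]→L[ℝ] ℝ)
    (a b : V [⋀^Fin 2]→L[ℝ] ℝ) (v w : V) :
    contraction Z (n := 2) (wedge a b) ![v, w] =
      contraction Z (n := 0) a ![] * b ![v, w] + a ![v, w] * contraction Z (n := 0) b ![] -
        (formSharp a (bivectorSharp Z (formSharp b v)) w +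
          formSharp b (bivectorSharp Z (formSharp a v)) w) := by
  set e := Module.finBasis ℝ V with he
  set z := fun i j => Z ![dualCoord e i, dualCoord e j] with hz
  have zswap : ∀ i j, z i j = - z j i := fun i j => apply_swap Z _ _
  have hsharp : ∀ a b : V [⋀^Fin 2]→L[ℝ] ℝ, formSharp b (bivectorSharp Z (formSharp a v)) w =
      ∑ i, ∑ j, z i j * (a ![v, e i] * b ![e j, w]) := by
    intro a b
    have h : formSharp a v = ∑ i, a ![v, e i] • dualCoord e i := dual_eq_sum e (formSharp a v)
    have h2 : ∀ ξ, formSharp b (bivectorSharp Z ξ) w = ∑ j, Z ![ξ, dualCoord e j] * b ![e j, w] := by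
      intro ξ
      change formSharp b (∑ j, Z ![ξ, dualCoord e j] • e j) w = _
      simp [map_sum, formSharp_apply]
    rw [h2]
    have h3 : ∀ j, Z ![formSharp a v, dualCoord e j] = ∑ i, a ![v, e i] * z i j := by
      intro j
      rw [← formSharp_apply, h]
      simp [map_sum, formSharp_apply, hz]
    simp_rw [h3, Finset.sum_mul]
    rw [Finset.sum_comm]
    exact Finset.sum_congr rfl fun i _ => Finset.sum_congr rfl fun j _ => by ring
  have swap : ∀ f : _ → _ → ℝ, ∑ i, ∑ j, z i j * f j i = - ∑ i, ∑ j, z i j * f i j := by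
    intro f
    rw [Finset.sum_comm, ← Finset.sum_neg_distrib]
    refine Finset.sum_congr rfl fun i _ => ?_
    rw [← Finset.sum_neg_distrib]
    exact Finset.sum_congr rfl fun j _ => by rw [zswap]; ring
  rw [hsharp, hsharp, contraction_apply, contraction_apply, contraction_apply]
  have hw : ∀ i j, wedge a b (Matrix.vecCons (e j) (Matrix.vecCons (e i) ![v, w])) = _ :=
    fun i j => wedge_two_two a b (e j) (e i) v w
  simp only [← he, hw]
  change 2⁻¹ * ∑ i, ∑ j, z i j * _ = 2⁻¹ * (∑ i, ∑ j, z i j * a ![e j, e i]) * _ +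
    _ * (2⁻¹ * ∑ i, ∑ j, z i j * b ![e j, e i]) - _
  have s1 := swap fun i j => a ![v, e i] * b ![e j, w]
  have s2 := swap fun i j => b ![v, e i] * a ![e j, w]
  have expand : ∀ i j, z i j * (a ![e j, e i] * b ![v, w] - a ![e j, v] * b ![e i, w] +
      a ![e j, w] * b ![e i, v] + a ![e i, v] * b ![e j, w] - a ![e i, w] * b ![e j, v] +
      a ![v, w] * b ![e j, e i]) = z i j * a ![e j, e i] * b ![v, w] +
      z i j * b ![e j, e i] * a ![v, w] + z i j * (a ![v, e j] * b ![e i, w]) -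
      z i j * (b ![v, e i] * a ![e j, w]) - z i j * (a ![v, e i] * b ![e j, w]) +
      z i j * (b ![v, e j] * a ![e i, w]) := by
    intro i j
    rw [apply_swap a v (e j), apply_swap a v (e i), apply_swap b v (e j), apply_swap b v (e i)]
    ring
  simp only [expand, Finset.sum_add_distrib, Finset.sum_sub_distrib, ← Finset.sum_mul]
  rw [s1, s2]
  ring

end AltForm
end BracketOfTwoForms

noncomputable section TaylorCoefficients
open AltForm

variable {E : Type*} [NormedAddCommGroup E] [NormedSpace ℝ E]
  {M : Type*} [TopologicalSpace M] [ChartedSpace E M] [IsManifold 𝓘(ℝ, E) ∞ M]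
  [FiniteDimensional ℝ E]

/-- The 2-form `f b` for a function `f`, that is, a 0-form. -/
def smulForm (f : DForm E M 0) (b : DForm E M 2) : DForm E M 2 := wedgeForm f b

/-- The 2-form `b f` for a function `f`, that is, a 0-form. -/
def formSmul (b : DForm E M 2) (f : DForm E M 0) : DForm E M 2 := wedgeForm b f

/-- The 2-form `ι_Z (a ∧ b) - ι_Z a ∧ b - a ∧ ι_Z b` for 2-forms `a`, `b`. The last two summands have
the degrees `0 + 2` and `2 + 0`, which `smulForm` and `formSmul` identify with `2`. -/
def twoFormBracket (Z : Bivector E M) (a b : DForm E M 2) : DForm E M 2 :=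
  contractForm Z (n := 2) (wedgeForm a b) - smulForm (contractForm Z (n := 0) a) b -
    formSmul a (contractForm Z (n := 0) b)

theorem totalCon_homForm_two (Z : Bivector E M) (a : DForm E M 2) :
    totalCon (contractFormₗ Z) (homForm E M 2 a) = homForm E M 0 (contractForm Z (n := 0) a) :=
  totalCon_add_two (contractFormₗ Z) (n := 0) a

theorem totalMul_homForm_zero_two (f : DForm E M 0) (b : DForm E M 2) :
    totalMul (wedgeFormₗ E M) (homForm E M 0 f) (homForm E M 2 b) =
      homForm E M 2 (smulForm f b) :=
  totalMul_lof (wedgeFormₗ E M) f b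

theorem totalMul_homForm_two_zero (f : DForm E M 0) (b : DForm E M 2) :
    totalMul (wedgeFormₗ E M) (homForm E M 2 b) (homForm E M 0 f) =
      homForm E M 2 (formSmul b f) :=
  totalMul_lof (wedgeFormₗ E M) b f

theorem totalCon_totalMul_homForm_two_two (Z : Bivector E M) (a b : DForm E M 2) :
    totalCon (contractFormₗ Z)
      (totalMul (wedgeFormₗ E M) (homForm E M 2 a) (homForm E M 2 b)) =
      homForm E M 2 (contractForm Z (n := 2) (wedgeForm a b)) :=
  (congrArg _ (totalMul_lof (wedgeFormₗ E M) a b)).trans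
    (totalCon_add_two (contractFormₗ Z) (n := 2) (wedgeForm a b))

theorem koszulBracket_homForm_two (Z : Bivector E M) (a b : DForm E M 2) :
    koszulBracket Z (homForm E M 2 a) (homForm E M 2 b) = homForm E M 2 (twoFormBracket Z a b) := by
  rw [koszulBracket, derivationDefect_apply, totalCon_totalMul_homForm_two_two,
    totalCon_homForm_two, totalCon_homForm_two, totalMul_homForm_zero_two,
    totalMul_homForm_two_zero, twoFormBracket, map_sub, map_sub]

theorem formSharp_twoFormBracket (Z : Bivector E M) (a b : DForm E M 2) (x : M) :
    formSharp (twoFormBracket Z a b x) =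
      -(formSharp (a x) ∘ₗ bivectorSharp (Z x) ∘ₗ formSharp (b x) +
        formSharp (b x) ∘ₗ bivectorSharp (Z x) ∘ₗ formSharp (a x)) := by
  refine LinearMap.ext fun v => ContinuousLinearMap.ext fun w => ?_
  have h := contraction_wedge_two_two (Z x) (a x) (b x) v w
  have h1 := wedge_zero_left (contraction (Z x) (n := 0) (a x)) (b x) v w
  have h2 := wedge_zero_right (contraction (Z x) (n := 0) (b x)) (a x) v w
  change contraction (Z x) (n := 2) (wedge (a x) (b x)) ![v, w] -
    wedge (contraction (Z x) (n := 0) (a x)) (b x) ![v, w] -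
    wedge (a x) (contraction (Z x) (n := 0) (b x)) ![v, w] =
    -(formSharp (a x) (bivectorSharp (Z x) (formSharp (b x) v)) w +
      formSharp (b x) (bivectorSharp (Z x) (formSharp (a x) v)) w)
  rw [h, h1, h2]
  ring

/-- The 2-forms `γⱼ` with `γⱼ♯ = (-1)ʲ β♯ (Z♯ β♯)ʲ` (see `formSharp_geomForm`). They are defined by
`γ₀ = β` and `2 γⱼ₊₁ = K(β, γⱼ)` with the bracket `K` of 2-forms, so that they are smooth. -/
def geomForm (Z : Bivector E M) (β : DForm E M 2) : ℕ → DForm E M 2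
  | 0 => β
  | j + 1 => (2 : ℝ)⁻¹ • twoFormBracket Z β (geomForm Z β j)

/-- `Z♯ β♯` as an endomorphism of the tangent space. -/
abbrev sharpEnd (Z : Bivector E M) (β : DForm E M 2) (x : M) :
    Module.End ℝ (TangentSpace 𝓘(ℝ, E) x) :=
  bivectorSharp (Z x) ∘ₗ formSharp (β x)

theorem formSharp_smul {V : Type*} [AddCommGroup V] [Module ℝ V] [TopologicalSpace V]
    [IsTopologicalAddGroup V] [ContinuousSMul ℝ V] (c : ℝ) (a : V [⋀^Fin 2]→L[ℝ] ℝ) :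
    formSharp (c • a) = c • formSharp a := rfl

theorem formSharp_injective {V : Type*} [AddCommGroup V] [Module ℝ V] [TopologicalSpace V]
    [IsTopologicalAddGroup V] [ContinuousSMul ℝ V] :
    Function.Injective (formSharp : V [⋀^Fin 2]→L[ℝ] ℝ → V →ₗ[ℝ] V →L[ℝ] ℝ) := by
  intro a b h
  ext v
  have h1 : v = ![v 0, v 1] := by funext i; fin_cases i <;> rfl
  rw [h1, ← formSharp_apply, ← formSharp_apply, h]

theorem formSharp_geomForm (Z : Bivector E M) (β : DForm E M 2) (j : ℕ) (x : M) :
    formSharp (geomForm Z β j x) = (-1 : ℝ) ^ j • (formSharp (β x) ∘ₗ sharpEnd Z β x ^ j) := by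
  induction j with
  | zero => rw [pow_zero, pow_zero, one_smul]; rfl
  | succ j ih =>
    change formSharp ((2 : ℝ)⁻¹ • twoFormBracket Z β (geomForm Z β j) x) = _
    rw [formSharp_smul, formSharp_twoFormBracket, ih]
    have e1 : formSharp (β x) ∘ₗ bivectorSharp (Z x) ∘ₗ
        ((-1 : ℝ) ^ j • (formSharp (β x) ∘ₗ sharpEnd Z β x ^ j)) =
        (-1 : ℝ) ^ j • (formSharp (β x) ∘ₗ sharpEnd Z β x ^ (j + 1)) := by
      rw [pow_succ', LinearMap.comp_smul, LinearMap.comp_smul]; rfl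
    have e2 : ((-1 : ℝ) ^ j • (formSharp (β x) ∘ₗ sharpEnd Z β x ^ j)) ∘ₗ bivectorSharp (Z x) ∘ₗ
        formSharp (β x) = (-1 : ℝ) ^ j • (formSharp (β x) ∘ₗ sharpEnd Z β x ^ (j + 1)) := by
      rw [pow_succ, LinearMap.smul_comp]; rfl
    rw [e1, e2, pow_succ (-1 : ℝ)]
    module

theorem twoFormBracket_geomForm (Z : Bivector E M) (β : DForm E M 2) (i j : ℕ) :
    twoFormBracket Z (geomForm Z β i) (geomForm Z β j) = (2 : ℝ) • geomForm Z β (i + j + 1) := by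
  ext1 x
  apply formSharp_injective
  change _ = formSharp ((2 : ℝ) • geomForm Z β (i + j + 1) x)
  rw [formSharp_smul, formSharp_twoFormBracket, formSharp_geomForm, formSharp_geomForm,
    formSharp_geomForm]
  have e : ∀ i j : ℕ, ((-1 : ℝ) ^ i • (formSharp (β x) ∘ₗ sharpEnd Z β x ^ i)) ∘ₗ
      bivectorSharp (Z x) ∘ₗ ((-1 : ℝ) ^ j • (formSharp (β x) ∘ₗ sharpEnd Z β x ^ j)) =
      (-1 : ℝ) ^ (i + j) • (formSharp (β x) ∘ₗ sharpEnd Z β x ^ (i + j + 1)) := by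
    intro i j
    rw [add_assoc, add_comm j 1, pow_add _ i (1 + j), pow_add _ 1 j, pow_one, pow_add,
      LinearMap.comp_smul, LinearMap.comp_smul, LinearMap.smul_comp, smul_smul, mul_comm]
    rfl
  rw [e, e, add_comm j i, pow_succ]
  module

theorem psiCoeff_succ (Z : Bivector E M) (β : DForm E M 2) (j : ℕ) :
    (psiCoeff Z (j + 1) fun _ => homForm E M 2 β) =
      homForm E M 2 (((j + 1).factorial : ℝ) • geomForm Z β j) := by
  rw [map_smul]
  refine GSym.taylor_locExp_coder (γ := geomForm Z β) (koszulBracket_isKoszulSymmetric Z)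
    even_two (fun i j => ?_) j
  rw [koszulBracket_homForm_two, twoFormBracket_geomForm, map_smul]

theorem psiCoeff_zero (Z : Bivector E M) (x : Fin 0 → Forms E M) : psiCoeff Z 0 x = 0 := by
  have h : koszulExp Z 1 = 1 := by
    change ∑ᶠ j : ℕ, ((j.factorial : ℝ)⁻¹) • (koszulCoder Z ^ j) 1 = 1
    rw [finsum_eq_single _ 0]
    · simp
    · intro j hj
      obtain ⟨k, rfl⟩ := Nat.exists_eq_succ_of_ne_zero hj
      have : koszulCoder Z 1 = 0 := GSym.coder_one _ _
      rw [pow_succ, Module.End.mul_apply, this, map_zero, smul_zero]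
  rw [psiCoeff, GSym.taylor, List.ofFn_zero, List.prod_nil, h, GSym.proj_one]

theorem psiCoeff_eq_homForm (Z : Bivector E M) (β : DForm E M 2) (k : ℕ) :
    (psiCoeff Z k fun _ => homForm E M 2 β) =
      homForm E M 2 ((psiCoeff Z k fun _ => homForm E M 2 β) 2) := by
  cases k with
  | zero => simp [psiCoeff_zero]
  | succ j =>
    rw [psiCoeff_succ]
    exact congrArg _ (DirectSum.of_eq_same 2 _).symm

theorem psiTerm_succ (Z : Bivector E M) (β : DForm E M 2) (j : ℕ) :
    psiTerm Z β (j + 1) = geomForm Z β j := by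
  rw [psiTerm, psiCoeff_succ]
  have h : (homForm E M 2 (((j + 1).factorial : ℝ) • geomForm Z β j)) 2 =
      ((j + 1).factorial : ℝ) • geomForm Z β j := DirectSum.of_eq_same 2 _
  rw [h, smul_smul, inv_mul_cancel₀ (by positivity), one_smul]

end TaylorCoefficients

/-! ### Sharp maps in coordinates -/

noncomputable section LocalSharpMaps
namespace AltForm

section
variable {E : Type*} [NormedAddCommGroup E] [NormedSpace ℝ E] [FiniteDimensional ℝ E]

-- Shortcuts: the default instance search for these iterated function spaces is too slow.
local instance : AddCommGroup (E →L[ℝ] E →L[ℝ] ℝ) := ContinuousLinearMap.addCommGroup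
local instance : AddCommGroup ((E →L[ℝ] ℝ) →L[ℝ] E) := ContinuousLinearMap.addCommGroup
local instance : AddCommGroup ((E →L[ℝ] ℝ) [⋀^Fin 2]→L[ℝ] ℝ) :=
  ContinuousAlternatingMap.instAddCommGroup

variable (E) in
/-- The sharp map `b ↦ b♯` of 2-forms on `E`, as a continuous linear map. -/
def sharpL : E [⋀^Fin 2]→L[ℝ] ℝ →L[ℝ] E →L[ℝ] E →L[ℝ] ℝ :=
  let f : E [⋀^Fin 2]→L[ℝ] ℝ →ₗ[ℝ] E →L[ℝ] E →L[ℝ] ℝ :=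
    { toFun := fun b => LinearMap.toContinuousLinearMap (formSharp b)
      map_add' := fun _ _ => rfl
      map_smul' := fun _ _ => rfl }
  ⟨f, LinearMap.continuous_of_finiteDimensional f⟩

theorem sharpL_apply (b : E [⋀^Fin 2]→L[ℝ] ℝ) (v w : E) : sharpL E b v w = b ![v, w] := rfl

theorem exists_unsharp :
    ∃ ρ : (E →L[ℝ] E →L[ℝ] ℝ) →L[ℝ] E [⋀^Fin 2]→L[ℝ] ℝ, ∀ b, ρ (sharpL E b) = b := by
  have hinj : LinearMap.ker (sharpL E).toLinearMap = ⊥ := by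
    refine LinearMap.ker_eq_bot.2 fun a b h => formSharp_injective ?_
    refine LinearMap.ext fun v => ?_
    exact DFunLike.congr_fun h v
  obtain ⟨ρ, hρ⟩ := LinearMap.exists_leftInverse_of_injective _ hinj
  exact ⟨⟨ρ, LinearMap.continuous_of_finiteDimensional ρ⟩, fun b => LinearMap.congr_fun hρ b⟩

variable (E) in
/-- A left inverse of `b ↦ b♯`. -/
def unsharpL : (E →L[ℝ] E →L[ℝ] ℝ) →L[ℝ] E [⋀^Fin 2]→L[ℝ] ℝ := exists_unsharp.choose

theorem unsharpL_sharpL (b : E [⋀^Fin 2]→L[ℝ] ℝ) : unsharpL E (sharpL E b) = b :=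
  exists_unsharp.choose_spec b

theorem bivectorSharp_apply (z : (E →L[ℝ] ℝ) [⋀^Fin 2]→L[ℝ] ℝ) (ξ : E →L[ℝ] ℝ) :
    bivectorSharp z ξ =
      ∑ i, z ![ξ, dualCoord (Module.finBasis ℝ E) i] • Module.finBasis ℝ E i := rfl

variable (E) in
/-- The sharp map `z ↦ z♯` of bivectors on `E`, as a continuous linear map. -/
def bivSharpL : (E →L[ℝ] ℝ) [⋀^Fin 2]→L[ℝ] ℝ →L[ℝ] (E →L[ℝ] ℝ) →L[ℝ] E :=
  let f : (E →L[ℝ] ℝ) [⋀^Fin 2]→L[ℝ] ℝ →ₗ[ℝ] (E →L[ℝ] ℝ) →L[ℝ] E :=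
    { toFun := fun z => LinearMap.toContinuousLinearMap (bivectorSharp z)
      map_add' := fun z z' => by
        refine ContinuousLinearMap.ext fun ξ => ?_
        change bivectorSharp (z + z') ξ = bivectorSharp z ξ + bivectorSharp z' ξ
        simp only [bivectorSharp_apply, ContinuousAlternatingMap.add_apply, add_smul,
          Finset.sum_add_distrib]
      map_smul' := fun c z => by
        refine ContinuousLinearMap.ext fun ξ => ?_
        change bivectorSharp (c • z) ξ = c • bivectorSharp z ξ
        simp only [bivectorSharp_apply, ContinuousAlternatingMap.smul_apply, smul_assoc,
          Finset.smul_sum] }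
  ⟨f, LinearMap.continuous_of_finiteDimensional f⟩

theorem sharpL_compContinuousLinearMap (b : E [⋀^Fin 2]→L[ℝ] ℝ) (G : E →L[ℝ] E) :
    sharpL E (b.compContinuousLinearMap G) =
      ((ContinuousLinearMap.compL ℝ E E ℝ).flip G).comp ((sharpL E b).comp G) := by
  ext v w
  rw [sharpL_apply, ContinuousAlternatingMap.compContinuousLinearMap_apply]
  change _ = b ![G v, G w]
  congr 1
  funext i
  fin_cases i <;> rfl

/-- The endomorphism `z♯ b♯` of `E`. -/
def modelEnd (z : (E →L[ℝ] ℝ) [⋀^Fin 2]→L[ℝ] ℝ) (b : E [⋀^Fin 2]→L[ℝ] ℝ) : E →L[ℝ] E :=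
  (bivSharpL E z).comp (sharpL E b)

variable {V : Type*} [AddCommGroup V] [Module ℝ V] [TopologicalSpace V]

/-- Conjugation `A ↦ φ⁻¹ A φ` with an isomorphism `φ : E ≃ V`. -/
def conjEnd (φ : E ≃L[ℝ] V) : Module.End ℝ V ≃ₐ[ℝ] (E →L[ℝ] E) :=
  (φ.symm.toLinearEquiv.conjAlgEquiv ℝ).trans (Module.End.toContinuousLinearMap E)

theorem conjEnd_apply (φ : E ≃L[ℝ] V) (A : Module.End ℝ V) (v : E) :
    conjEnd φ A v = φ.symm (A (φ v)) := rfl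

theorem conjEnd_trans (g : E ≃L[ℝ] E) (φ : E ≃L[ℝ] V) (A : Module.End ℝ V) :
    conjEnd (g.trans φ) A = (g.symm : E →L[ℝ] E) * conjEnd φ A * (g : E →L[ℝ] E) := rfl

theorem conjEnd_ringInverse (φ : E ≃L[ℝ] V) (A : Module.End ℝ V) :
    conjEnd φ (Ring.inverse A) = Ring.inverse (conjEnd φ A) := by
  by_cases h : IsUnit A
  · obtain ⟨u, rfl⟩ := h
    have : conjEnd φ (u : Module.End ℝ V) =
        ((Units.map (conjEnd φ : Module.End ℝ V →* (E →L[ℝ] E)) u : (E →L[ℝ] E)ˣ) :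
          E →L[ℝ] E) := rfl
    rw [this, Ring.inverse_unit, Ring.inverse_unit]
    rfl
  · rw [Ring.inverse_non_unit _ h, map_zero, Ring.inverse_non_unit]
    rwa [isUnit_map_iff]

/-- `1 + A` is invertible if a conjugate of `A` has norm less than one. -/
theorem isUnit_one_add_of_norm_conjEnd_lt_one (φ : E ≃L[ℝ] V) (A : Module.End ℝ V)
    (h : ‖conjEnd φ A‖ < 1) : IsUnit (1 + A) := by
  have h1 : IsUnit (conjEnd φ (1 + A)) := by
    rw [map_add, map_one, ← sub_neg_eq_add]
    exact isUnit_one_sub_of_norm_lt_one (by rwa [norm_neg])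
  rwa [isUnit_map_iff] at h1

variable [IsTopologicalAddGroup V] [ContinuousSMul ℝ V] [T2Space V] [FiniteDimensional ℝ V]

theorem modelEnd_comp (φ : E ≃L[ℝ] V) (Z : (V →L[ℝ] ℝ) [⋀^Fin 2]→L[ℝ] ℝ)
    (z : (E →L[ℝ] ℝ) [⋀^Fin 2]→L[ℝ] ℝ)
    (hz : ∀ ξ η : V →L[ℝ] ℝ, z ![ξ.comp φ.toContinuousLinearMap, η.comp φ.toContinuousLinearMap]
      = Z ![ξ, η]) (β : V [⋀^Fin 2]→L[ℝ] ℝ) :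
    modelEnd z (β.compContinuousLinearMap φ.toContinuousLinearMap) =
      conjEnd φ (bivectorSharp Z ∘ₗ formSharp β) := by
  ext v
  rw [conjEnd_apply, ContinuousLinearEquiv.eq_symm_apply]
  refine (Module.finBasis ℝ V).ext_elem fun i => ?_
  have h1 : sharpL E (β.compContinuousLinearMap φ.toContinuousLinearMap) v =
      (formSharp β (φ v)).comp φ.toContinuousLinearMap := by
    ext w
    rw [sharpL_apply, ContinuousAlternatingMap.compContinuousLinearMap_apply]
    change _ = β ![φ v, φ w]
    congr 1
    funext i
    fin_cases i <;> rfl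
  set η := dualCoord (Module.finBasis ℝ V) i
  change (η.comp φ.toContinuousLinearMap) (bivectorSharp z
    (sharpL E (β.compContinuousLinearMap φ.toContinuousLinearMap) v)) =
    η (bivectorSharp Z (formSharp β (φ v)))
  rw [apply_bivectorSharp, apply_bivectorSharp, h1, hz]

omit [T2Space V] [FiniteDimensional ℝ V] in
theorem sharpL_comp (φ : E ≃L[ℝ] V) (a β : V [⋀^Fin 2]→L[ℝ] ℝ) (T : Module.End ℝ V)
    (h : formSharp a = formSharp β ∘ₗ T) :
    sharpL E (a.compContinuousLinearMap φ.toContinuousLinearMap) =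
      (sharpL E (β.compContinuousLinearMap φ.toContinuousLinearMap)).comp (conjEnd φ T) := by
  have h1 : ∀ (β : V [⋀^Fin 2]→L[ℝ] ℝ) v w,
      sharpL E (β.compContinuousLinearMap φ.toContinuousLinearMap) v w =
      formSharp β (φ v) (φ w) := by
    intro β v w
    rw [sharpL_apply, ContinuousAlternatingMap.compContinuousLinearMap_apply, formSharp_apply]
    congr 1
    funext i
    fin_cases i <;> rfl
  ext v w
  rw [h1, h, ContinuousLinearMap.comp_apply, h1, conjEnd_apply, φ.apply_symm_apply]
  rfl
end
end AltForm

open AltForm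

variable {E : Type*} [NormedAddCommGroup E] [NormedSpace ℝ E] [FiniteDimensional ℝ E]
  {M : Type*} [TopologicalSpace M] [ChartedSpace E M] [IsManifold 𝓘(ℝ, E) ∞ M]

/-- The isomorphism `E ≃ TₓM` given by the trivialisation over the chart at `x₀`. -/
def frameAt (x₀ x : M) (hx : x ∈ (chartAt E x₀).source) : E ≃L[ℝ] TangentSpace 𝓘(ℝ, E) x :=
  ((trivializationAt E (TangentSpace 𝓘(ℝ, E)) x₀).continuousLinearEquivAt ℝ x hx).symm

omit [FiniteDimensional ℝ E] in
theorem coe_frameAt (x₀ x : M) (hx : x ∈ (chartAt E x₀).source) :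
    (frameAt x₀ x hx).toContinuousLinearMap =
      (trivializationAt E (TangentSpace 𝓘(ℝ, E)) x₀).symmL ℝ x := by
  ext v
  exact congrFun (Trivialization.symm_continuousLinearEquivAt_eq _ hx) v

omit [FiniteDimensional ℝ E] in
theorem trivializationAt_altFiber_snd (x₀ x : M) (hx : x ∈ (chartAt E x₀).source) {n : ℕ}
    (a : AltFiber E M n x) :
    (trivializationAt (E [⋀^Fin n]→L[ℝ] ℝ) (AltFiber E M n) x₀ ⟨x, a⟩).2 =
      a.compContinuousLinearMap (frameAt x₀ x hx).toContinuousLinearMap := by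
  rw [coe_frameAt]
  change ContinuousAlternatingMap.inCoordinates E ℝ x₀ x x₀ x a = _
  ext v
  simp [ContinuousAlternatingMap.inCoordinates, Function.comp_def]

omit [FiniteDimensional ℝ E] in
theorem localForm_eq_frameAt (x₀ x : M) (hx : x ∈ (chartAt E x₀).source) {n : ℕ}
    (a : ∀ x, AltFiber E M n x) :
    localForm x₀ a x = (a x).compContinuousLinearMap (frameAt x₀ x hx).toContinuousLinearMap :=
  trivializationAt_altFiber_snd x₀ x hx (a x)

omit [FiniteDimensional ℝ E] in
theorem localBiv_frameAt (x₀ x : M) (hx : x ∈ (chartAt E x₀).source) (Z : ∀ x, BivFiber E M x)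
    (ξ η : TangentSpace 𝓘(ℝ, E) x →L[ℝ] ℝ) :
    localBiv x₀ Z x ![ξ.comp (frameAt x₀ x hx).toContinuousLinearMap,
      η.comp (frameAt x₀ x hx).toContinuousLinearMap] = Z x ![ξ, η] := by
  rw [coe_frameAt]
  exact localBiv_apply x₀ Z x hx ξ η

theorem modelEnd_localBiv (x₀ x : M) (hx : x ∈ (chartAt E x₀).source) (Z : ∀ x, BivFiber E M x)
    (b : AltFiber E M 2 x) :
    modelEnd (localBiv x₀ Z x)
      (b.compContinuousLinearMap (frameAt x₀ x hx).toContinuousLinearMap) =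
      conjEnd (frameAt x₀ x hx) (bivectorSharp (Z x) ∘ₗ formSharp b) :=
  modelEnd_comp _ _ _ (localBiv_frameAt x₀ x hx Z) b

omit [FiniteDimensional ℝ E] [IsManifold 𝓘(ℝ, E) ∞ M] in
set_option synthInstance.maxHeartbeats 40000 in
/-- Pulling back a 2-form along an endomorphism depends smoothly on both. -/
theorem _root_.ContMDiffAt.compContinuousLinearMap_two {F : Type*} [NormedAddCommGroup F]
    [NormedSpace ℝ F] [FiniteDimensional ℝ F] {b : M → F [⋀^Fin 2]→L[ℝ] ℝ} {G : M → F →L[ℝ] F}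
    {x : M} (hb : ContMDiffAt 𝓘(ℝ, E) 𝓘(ℝ, F [⋀^Fin 2]→L[ℝ] ℝ) ∞ b x)
    (hG : ContMDiffAt 𝓘(ℝ, E) 𝓘(ℝ, F →L[ℝ] F) ∞ G x) :
    ContMDiffAt 𝓘(ℝ, E) 𝓘(ℝ, F [⋀^Fin 2]→L[ℝ] ℝ) ∞
      (fun y => (b y).compContinuousLinearMap (G y)) x := by
  have h : (fun y => (b y).compContinuousLinearMap (G y)) = fun y => unsharpL F
      (((ContinuousLinearMap.compL ℝ F F ℝ).flip (G y)).comp ((sharpL F (b y)).comp (G y))) := by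
    funext y
    rw [← sharpL_compContinuousLinearMap, unsharpL_sharpL]
  rw [h]
  have h1 : ContMDiffAt 𝓘(ℝ, E) 𝓘(ℝ, F →L[ℝ] F →L[ℝ] ℝ) ∞ (fun y => sharpL F (b y)) x :=
    ContMDiffAt.comp (g := sharpL F) x (show ContDiff ℝ ∞ (sharpL F) by fun_prop).contMDiff.contMDiffAt hb
  have h2 : ContMDiffAt 𝓘(ℝ, E) 𝓘(ℝ, (F →L[ℝ] ℝ) →L[ℝ] F →L[ℝ] ℝ) ∞
      (fun y => (ContinuousLinearMap.compL ℝ F F ℝ).flip (G y)) x :=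
    ContMDiffAt.comp (g := (ContinuousLinearMap.compL ℝ F F ℝ).flip) x
      (show ContDiff ℝ ∞ (ContinuousLinearMap.compL ℝ F F ℝ).flip by fun_prop).contMDiff.contMDiffAt hG
  exact ContMDiffAt.comp (g := unsharpL F) x
    (show ContDiff ℝ ∞ (unsharpL F) by fun_prop).contMDiff.contMDiffAt (h2.clm_comp (h1.clm_comp hG))

/-- The coordinate change of the tangent bundle from the chart at `x₀` to the chart at `x₁`. -/
def tangentChange (x₀ x₁ x : M) : E →L[ℝ] E :=
  ((trivializationAt E (TangentSpace 𝓘(ℝ, E)) x₀).coordChangeL ℝ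
    (trivializationAt E (TangentSpace 𝓘(ℝ, E)) x₁) x : E ≃L[ℝ] E)

omit [FiniteDimensional ℝ E] in
theorem contMDiffAt_tangentChange (x₀ x₁ x : M) (h₀ : x ∈ (chartAt E x₀).source)
    (h₁ : x ∈ (chartAt E x₁).source) :
    ContMDiffAt 𝓘(ℝ, E) 𝓘(ℝ, E →L[ℝ] E) ∞ (fun y => tangentChange (E := E) x₀ x₁ y) x :=
  (contMDiffOn_coordChangeL (n := ∞) (IB := 𝓘(ℝ, E))
    (trivializationAt E (TangentSpace 𝓘(ℝ, E)) x₀)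
    (trivializationAt E (TangentSpace 𝓘(ℝ, E)) x₁)).contMDiffAt
    (((trivializationAt E (TangentSpace 𝓘(ℝ, E)) x₀).open_baseSet.inter
      (trivializationAt E (TangentSpace 𝓘(ℝ, E)) x₁).open_baseSet).mem_nhds ⟨h₀, h₁⟩)

omit [FiniteDimensional ℝ E] in
theorem frameAt_tangentChange (x₀ x₁ x : M) (h₀ : x ∈ (chartAt E x₀).source)
    (h₁ : x ∈ (chartAt E x₁).source) (v : E) :
    frameAt x₁ x h₁ (tangentChange x₀ x₁ x v) = frameAt x₀ x h₀ v := by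
  rw [tangentChange, ← ContinuousLinearEquiv.eq_symm_apply]
  change (trivializationAt E (TangentSpace 𝓘(ℝ, E)) x₀).coordChangeL ℝ
    (trivializationAt E (TangentSpace 𝓘(ℝ, E)) x₁) x v = _
  rw [Trivialization.coordChangeL_apply _ _ ⟨h₀, h₁⟩]
  rfl

theorem contMDiffOn_localForm_two (x₀ : M) (a : DForm E M 2) :
    ContMDiffOn 𝓘(ℝ, E) 𝓘(ℝ, E [⋀^Fin 2]→L[ℝ] ℝ) ∞ (localForm x₀ a) (chartAt E x₀).source := by
  intro x hx
  have hxx := mem_chart_source E x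
  refine ContMDiffAt.contMDiffWithinAt ?_
  refine (((contMDiff_iff_localForm _).1 a.contMDiff x).compContinuousLinearMap_two
    (contMDiffAt_tangentChange x₀ x x hx hxx)).congr_of_eventuallyEq ?_
  filter_upwards [(chartAt E x₀).open_source.mem_nhds hx, (chartAt E x).open_source.mem_nhds hxx]
    with y h₀ h₁
  rw [localForm_eq_frameAt x₀ y h₀, localForm_eq_frameAt x y h₁]
  ext v
  simp only [ContinuousAlternatingMap.compContinuousLinearMap_apply]
  congr 1
  funext i
  exact (frameAt_tangentChange x₀ x y h₀ h₁ (v i)).symm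

theorem contMDiffOn_localBiv (x₀ : M) (Z : Bivector E M) :
    ContMDiffOn 𝓘(ℝ, E) 𝓘(ℝ, (E →L[ℝ] ℝ) [⋀^Fin 2]→L[ℝ] ℝ) ∞ (localBiv x₀ Z)
      (chartAt E x₀).source := by
  intro x hx
  have hxx := mem_chart_source E x
  refine ContMDiffAt.contMDiffWithinAt ?_
  have hG : ContMDiffAt 𝓘(ℝ, E) 𝓘(ℝ, (E →L[ℝ] ℝ) →L[ℝ] E →L[ℝ] ℝ) ∞
      (fun y => (ContinuousLinearMap.compL ℝ E E ℝ).flip (tangentChange x x₀ y)) x :=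
    ContMDiffAt.comp (g := (ContinuousLinearMap.compL ℝ E E ℝ).flip) x
      (show ContDiff ℝ ∞ (ContinuousLinearMap.compL ℝ E E ℝ).flip by fun_prop).contMDiff.contMDiffAt
      (contMDiffAt_tangentChange x x₀ x hxx hx)
  refine ((contMDiffAt_localBiv Z x).compContinuousLinearMap_two hG).congr_of_eventuallyEq ?_
  filter_upwards [(chartAt E x₀).open_source.mem_nhds hx, (chartAt E x).open_source.mem_nhds hxx]
    with y h₀ h₁
  apply formSharp_injective
  refine LinearMap.ext fun ξ => ContinuousLinearMap.ext fun η => ?_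
  have e₀ : ∀ ξ : E →L[ℝ] ℝ, ξ = (ξ.comp (frameAt x₀ y h₀).symm.toContinuousLinearMap).comp
      (frameAt x₀ y h₀).toContinuousLinearMap := by
    intro ξ; ext v; simp
  have e₁ : ∀ ξ : E →L[ℝ] ℝ, ξ.comp (tangentChange x x₀ y) =
      (ξ.comp (frameAt x₀ y h₀).symm.toContinuousLinearMap).comp
        (frameAt x y h₁).toContinuousLinearMap := by
    intro ξ
    ext v
    simp [← frameAt_tangentChange x x₀ y h₁ h₀]
  have h : localBiv x₀ Z y ![ξ, η] = localBiv x Z y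
      ![ξ.comp (tangentChange x x₀ y), η.comp (tangentChange x x₀ y)] := by
    rw [e₁, e₁, localBiv_frameAt x y h₁ Z]
    conv_lhs => rw [e₀ ξ, e₀ η]
    exact localBiv_frameAt x₀ y h₀ Z _ _
  rw [formSharp_apply, formSharp_apply, h,
    ContinuousAlternatingMap.compContinuousLinearMap_apply]
  congr 1
  funext i
  fin_cases i <;> rfl

/-- The set of all `b ∈ ⋀² T*M` such that `Z♯ b♯` is conjugate to an endomorphism of `E` of norm less
than one, or, equivalently, has spectral radius less than one. -/
def smallLocus (Z : Bivector E M) : Set (TotalSpace (E [⋀^Fin 2]→L[ℝ] ℝ) (AltFiber E M 2)) :=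
  {p | ∃ φ : E ≃L[ℝ] TangentSpace 𝓘(ℝ, E) p.1,
    ‖conjEnd φ (bivectorSharp (Z p.1) ∘ₗ formSharp p.2)‖ < 1}

theorem smallLocus_subset (Z : Bivector E M) : smallLocus Z ⊆ invertibleLocus Z := by
  rintro p ⟨φ, hφ⟩
  exact isUnit_one_add_of_norm_conjEnd_lt_one φ _ hφ

theorem zero_mem_smallLocus (Z : Bivector E M) (x : M) :
    TotalSpace.mk x (0 : AltFiber E M 2 x) ∈ smallLocus Z := by
  refine ⟨frameAt x x (mem_chart_source E x), ?_⟩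
  have h : (bivectorSharp (Z x) ∘ₗ formSharp (0 : AltFiber E M 2 x) :
      Module.End ℝ (TangentSpace 𝓘(ℝ, E) x)) = 0 := by
    refine LinearMap.ext fun v => ?_
    have : formSharp (0 : AltFiber E M 2 x) v = 0 := rfl
    rw [LinearMap.comp_apply, this, map_zero]; rfl
  change ‖conjEnd _ (bivectorSharp (Z x) ∘ₗ formSharp (0 : AltFiber E M 2 x))‖ < 1
  rw [h, map_zero, norm_zero]
  exact one_pos

theorem isOpen_smallLocus (Z : Bivector E M) : IsOpen (smallLocus Z) := by
  rw [isOpen_iff_mem_nhds]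
  rintro ⟨x₀, b⟩ ⟨φ, hφ⟩
  have hx₀ := mem_chart_source E x₀
  set g : E ≃L[ℝ] E := φ.trans (frameAt x₀ x₀ hx₀).symm with hg
  have hgφ : g.trans (frameAt x₀ x₀ hx₀) = φ := by ext v; simp [hg]
  set e := trivializationAt (E [⋀^Fin 2]→L[ℝ] ℝ) (AltFiber E M 2) x₀
  let f : TotalSpace (E [⋀^Fin 2]→L[ℝ] ℝ) (AltFiber E M 2) → E →L[ℝ] E := fun q =>
    (g.symm : E →L[ℝ] E) * modelEnd (localBiv x₀ Z q.1) (e q).2 * (g : E →L[ℝ] E)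
  have hf : ∀ q : TotalSpace (E [⋀^Fin 2]→L[ℝ] ℝ) (AltFiber E M 2),
      ∀ hq : q.1 ∈ (chartAt E x₀).source, f q = conjEnd (g.trans (frameAt x₀ q.1 hq))
        (bivectorSharp (Z q.1) ∘ₗ formSharp q.2) := by
    intro q hq
    rw [conjEnd_trans, ← modelEnd_localBiv, ← trivializationAt_altFiber_snd]
  have hmem : (⟨x₀, b⟩ : TotalSpace (E [⋀^Fin 2]→L[ℝ] ℝ) (AltFiber E M 2)) ∈ e.source := by
    rw [e.mem_source]
    exact FiberBundle.mem_baseSet_trivializationAt' x₀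
  have hproj : Continuous (fun q : TotalSpace (E [⋀^Fin 2]→L[ℝ] ℝ) (AltFiber E M 2) => q.1) :=
    FiberBundle.continuous_proj _ _
  have hcont : ContinuousAt f ⟨x₀, b⟩ := by
    have h1 : ContinuousAt (fun q : TotalSpace (E [⋀^Fin 2]→L[ℝ] ℝ) (AltFiber E M 2) =>
        localBiv x₀ Z q.1) ⟨x₀, b⟩ :=
      ContinuousAt.comp (g := localBiv x₀ Z) (contMDiffAt_localBiv Z x₀).continuousAt hproj.continuousAt
    have h2 : ContinuousAt (fun q => (e q).2) ⟨x₀, b⟩ :=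
      continuous_snd.continuousAt.comp (e.continuousAt hmem)
    have h3 : ContinuousAt (fun q => modelEnd (localBiv x₀ Z q.1) (e q).2) ⟨x₀, b⟩ :=
      ((bivSharpL E).continuous.continuousAt.comp h1).clm_comp
        ((sharpL E).continuous.continuousAt.comp h2)
    exact (continuousAt_const.mul h3).mul continuousAt_const
  have h0 : ‖f ⟨x₀, b⟩‖ < 1 := by
    rw [hf _ hx₀]
    change ‖conjEnd (g.trans (frameAt x₀ x₀ hx₀)) _‖ < 1
    rw [hgφ]
    exact hφ
  filter_upwards [hcont.norm.eventually_lt_const h0, hproj.continuousAt.preimage_mem_nhds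
    ((chartAt E x₀).open_source.mem_nhds hx₀)] with q hq hq'
  exact ⟨g.trans (frameAt x₀ q.1 hq'), by rwa [hf q hq'] at hq⟩

end LocalSharpMaps

/-! ### Norms of jets -/

noncomputable section JetNorms

variable {E : Type*} [NormedAddCommGroup E] [NormedSpace ℝ E]
  {𝔸 : Type*} [NormedRing 𝔸] [NormedAlgebra ℝ 𝔸]
  {G : Type*} [NormedAddCommGroup G] [NormedSpace ℝ G]

/-- The weighted norm `∑_{k ≤ r} εᵏ / k! ‖Dᵏ f(y)‖` of the `r`-jet of `f` at `y`. -/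
def jetNorm (s : Set E) (r : ℕ) (ε : ℝ) (f : E → G) (y : E) : ℝ :=
  ∑ k ∈ Finset.range (r + 1), ε ^ k / k.factorial * ‖iteratedFDerivWithin ℝ k f s y‖

variable {s : Set E} {r : ℕ} {ε : ℝ}

theorem jetNorm_nonneg (hε : 0 ≤ ε) (f : E → G) (y : E) : 0 ≤ jetNorm s r ε f y :=
  Finset.sum_nonneg fun k _ => by positivity

theorem jetNorm_zero (f : E → G) (y : E) : jetNorm s r 0 f y = ‖f y‖ := by
  rw [jetNorm, Finset.sum_eq_single 0]
  · simp
  · intro k _ hk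
    simp [hk]
  · simp

theorem continuous_jetNorm_weight (f : E → G) (y : E) :
    Continuous fun ε => jetNorm s r ε f y := by
  unfold jetNorm
  fun_prop

/-- By the Leibniz rule, the weighted norms of jets are submultiplicative. -/
theorem jetNorm_mul_le (hs : IsOpen s) (hε : 0 ≤ ε) {f g : E → 𝔸} (hf : ContDiffOn ℝ ∞ f s)
    (hg : ContDiffOn ℝ ∞ g s) {y : E} (hy : y ∈ s) :
    jetNorm s r ε (fun y => f y * g y) y ≤ jetNorm s r ε f y * jetNorm s r ε g y := by
  set u : ℕ → ℝ := fun k => ε ^ k / k.factorial * ‖iteratedFDerivWithin ℝ k f s y‖ with hu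
  set v : ℕ → ℝ := fun k => ε ^ k / k.factorial * ‖iteratedFDerivWithin ℝ k g s y‖ with hv
  have hu0 : ∀ k, 0 ≤ u k := fun k => by positivity
  have hv0 : ∀ k, 0 ≤ v k := fun k => by positivity
  calc jetNorm s r ε (fun y => f y * g y) y
      ≤ ∑ k ∈ Finset.range (r + 1), ∑ i ∈ Finset.range (k + 1), u i * v (k - i) := by
        refine Finset.sum_le_sum fun k _ => ?_
        have h := norm_iteratedFDerivWithin_mul_le hf hg hs.uniqueDiffOn hy (n := k)
          (by exact_mod_cast le_top)
        refine (mul_le_mul_of_nonneg_left h (by positivity)).trans_eq ?_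
        rw [Finset.mul_sum]
        refine Finset.sum_congr rfl fun i hi => ?_
        have hik : i ≤ k := Nat.lt_succ_iff.1 (Finset.mem_range.1 hi)
        have hc : (k.choose i : ℝ) = k.factorial / (i.factorial * (k - i).factorial) :=
          Nat.cast_choose ℝ hik
        have hp : ε ^ k = ε ^ i * ε ^ (k - i) := by rw [← pow_add, Nat.add_sub_cancel' hik]
        rw [hu, hv, hc, hp]
        field_simp
    _ = ∑ i ∈ Finset.range (r + 1), ∑ j ∈ Finset.range (r + 1 - i), u i * v j :=
        Finset.sum_range_diag_flip _ fun i j => u i * v j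
    _ ≤ ∑ i ∈ Finset.range (r + 1), ∑ j ∈ Finset.range (r + 1), u i * v j := by
        refine Finset.sum_le_sum fun i _ => Finset.sum_le_sum_of_subset_of_nonneg ?_ ?_
        · exact Finset.range_subset_range.2 (Nat.sub_le _ _)
        · exact fun j _ _ => mul_nonneg (hu0 i) (hv0 j)
    _ = jetNorm s r ε f y * jetNorm s r ε g y := by
        rw [jetNorm, jetNorm, Finset.sum_mul_sum]

theorem jetNorm_pow_le (hs : IsOpen s) (hε : 0 ≤ ε) {f : E → 𝔸} (hf : ContDiffOn ℝ ∞ f s)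
    {y : E} (hy : y ∈ s) (N : ℕ) :
    jetNorm s r ε (fun y => f y ^ (N + 1)) y ≤ jetNorm s r ε f y ^ (N + 1) := by
  induction N with
  | zero => simp
  | succ N ih =>
    have h := jetNorm_mul_le (r := r) hs hε (hf.pow (N + 1)) hf hy
    simp only [← pow_succ] at h
    rw [pow_succ _ (N + 1)]
    exact h.trans (mul_le_mul_of_nonneg_right ih (jetNorm_nonneg hε _ _))

theorem continuousOn_norm_iteratedFDerivWithin (hs : IsOpen s) {f : E → G}
    (hf : ContDiffOn ℝ ∞ f s) (k : ℕ) :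
    ContinuousOn (fun y => ‖iteratedFDerivWithin ℝ k f s y‖) s :=
  (hf.continuousOn_iteratedFDerivWithin (by exact_mod_cast le_top) hs.uniqueDiffOn).norm

theorem continuousOn_jetNorm (hs : IsOpen s) {f : E → G} (hf : ContDiffOn ℝ ∞ f s) :
    ContinuousOn (jetNorm s r ε f) s :=
  continuousOn_finsetSum _ fun k _ =>
    (continuousOn_const.mul (continuousOn_norm_iteratedFDerivWithin hs hf k))

/-- Near a point where `‖f‖ < 1`, the derivatives of the powers of `f` decay geometrically. -/
theorem exists_norm_iteratedFDerivWithin_pow_le (hs : IsOpen s) {f : E → 𝔸}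
    (hf : ContDiffOn ℝ ∞ f s) {y₀ : E} (hy₀ : y₀ ∈ s) (h : ‖f y₀‖ < 1) (r : ℕ) :
    ∃ q C : ℝ, 0 ≤ q ∧ q < 1 ∧ 0 ≤ C ∧ ∀ᶠ y in 𝓝 y₀, ∀ k ≤ r, ∀ N : ℕ,
      ‖iteratedFDerivWithin ℝ k (fun y => f y ^ (N + 1)) s y‖ ≤ C * q ^ (N + 1) := by
  -- for small positive weights, the weighted norm of the `r`-jet of `f` at `y₀` is less than one
  obtain ⟨ε, hε, hlt⟩ : ∃ ε : ℝ, 0 < ε ∧ jetNorm s r ε f y₀ < 1 := by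
    have hev : ∀ᶠ ε in 𝓝 (0 : ℝ), jetNorm s r ε f y₀ < 1 :=
      (continuous_jetNorm_weight f y₀).continuousAt.eventually_lt_const
        (by rwa [← jetNorm_zero (s := s) (r := r) f y₀] at h)
    have := (hev.filter_mono nhdsWithin_le_nhds).and (self_mem_nhdsWithin (s := Set.Ioi (0 : ℝ)))
    obtain ⟨ε, h1, h2⟩ := this.exists
    exact ⟨ε, h2, h1⟩
  obtain ⟨q, hq, hq1⟩ := exists_between hlt
  have hq0 : 0 ≤ q := (jetNorm_nonneg hε.le f y₀).trans hq.le
  refine ⟨q, ∑ k ∈ Finset.range (r + 1), k.factorial / ε ^ k, hq0, hq1,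
    Finset.sum_nonneg fun k _ => by positivity, ?_⟩
  filter_upwards [hs.mem_nhds hy₀, ((continuousOn_jetNorm hs hf).continuousAt
    (hs.mem_nhds hy₀)).eventually_lt_const hq] with y hy hyq k hk N
  have hk' : k ∈ Finset.range (r + 1) := Finset.mem_range.2 (Nat.lt_succ_of_le hk)
  have h1 : ε ^ k / k.factorial * ‖iteratedFDerivWithin ℝ k (fun y => f y ^ (N + 1)) s y‖ ≤
      q ^ (N + 1) := by
    refine le_trans ?_ ((jetNorm_pow_le (r := r) hs hε.le hf hy N).trans
      (pow_le_pow_left₀ (jetNorm_nonneg hε.le _ _) hyq.le _))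
    exact Finset.single_le_sum (f := fun k => ε ^ k / (k.factorial : ℝ) *
      ‖iteratedFDerivWithin ℝ k (fun y => f y ^ (N + 1)) s y‖) (fun i _ => by positivity) hk'
  have h2 : ‖iteratedFDerivWithin ℝ k (fun y => f y ^ (N + 1)) s y‖ ≤
      k.factorial / ε ^ k * q ^ (N + 1) := by
    have hpos : 0 < ε ^ k / (k.factorial : ℝ) := by positivity
    rw [← inv_div, ← div_eq_inv_mul, le_div_iff₀ hpos, mul_comm]
    exact h1
  refine h2.trans (mul_le_mul_of_nonneg_right ?_ (by positivity))
  exact Finset.single_le_sum (f := fun k => (k.factorial : ℝ) / ε ^ k)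
    (fun i _ => by positivity) hk'

/-- If `f` has values conjugate to elements of norm less than one, then `T (f ^ N)` tends to zero
locally uniformly with all derivatives. -/
theorem tendstoLocallyUniformlyOn_iteratedFDeriv_clm_apply_pow (hs : IsOpen s) {f : E → 𝔸}
    (hf : ContDiffOn ℝ ∞ f s) {T : E → 𝔸 →L[ℝ] G} (hT : ContDiffOn ℝ ∞ T s)
    (h : ∀ y ∈ s, ∃ g : 𝔸ˣ, ‖(↑g⁻¹ * f y * g : 𝔸)‖ < 1) (r : ℕ) :
    TendstoLocallyUniformlyOn (fun (N : ℕ) y => iteratedFDeriv ℝ r (fun y => T y (f y ^ N)) y)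
      (fun _ => 0) atTop s := by
  rw [tendstoLocallyUniformlyOn_iff_forall_tendsto]
  intro y₀ hy₀
  obtain ⟨g, hg⟩ := h y₀ hy₀
  set f' : E → 𝔸 := fun y => ↑g⁻¹ * f y * g with hf'
  set T' : E → 𝔸 →L[ℝ] G := fun y =>
    (T y).comp (ContinuousLinearMap.mulLeftRight ℝ 𝔸 g ↑g⁻¹) with hT'
  have hfs : ContDiffOn ℝ ∞ f' s := (contDiffOn_const.mul hf).mul contDiffOn_const
  have hTs : ContDiffOn ℝ ∞ T' s := hT.clm_comp contDiffOn_const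
  have heq : ∀ N : ℕ, (fun y => T y (f y ^ N)) = fun y => T' y (f' y ^ N) := by
    intro N
    funext y
    rw [hT', hf']
    simp only [ContinuousLinearMap.comp_apply, ContinuousLinearMap.mulLeftRight_apply,
      Units.conj_pow', ← mul_assoc, Units.mul_inv, one_mul, Units.mul_inv_cancel_right]
  obtain ⟨q, C, hq0, hq1, hC, hev⟩ := exists_norm_iteratedFDerivWithin_pow_le hs hfs hy₀ hg r
  set B : ℝ := ∑ i ∈ Finset.range (r + 1),
    (r.choose i : ℝ) * (‖iteratedFDerivWithin ℝ i T' s y₀‖ + 1) * C with hB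
  have hTev : ∀ᶠ y in 𝓝 y₀, ∀ i ∈ Finset.range (r + 1),
      ‖iteratedFDerivWithin ℝ i T' s y‖ < ‖iteratedFDerivWithin ℝ i T' s y₀‖ + 1 :=
    (Filter.eventually_all_finset _).2 fun i _ =>
      ((continuousOn_norm_iteratedFDerivWithin hs hTs i).continuousAt
        (hs.mem_nhds hy₀)).eventually_lt_const (lt_add_one _)
  have hbound : ∀ᶠ y in 𝓝 y₀, ∀ N : ℕ,
      ‖iteratedFDeriv ℝ r (fun y => T y (f y ^ (N + 1))) y‖ ≤ B * q ^ (N + 1) := by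
    filter_upwards [hs.mem_nhds hy₀, hev, hTev] with y hy hy1 hy2 N
    rw [heq, ← iteratedFDerivWithin_of_isOpen r hs hy]
    refine (norm_iteratedFDerivWithin_clm_apply hTs (hfs.pow (N + 1)) hs.uniqueDiffOn hy
      (n := r) (by exact_mod_cast le_top)).trans ?_
    rw [hB, Finset.sum_mul]
    refine Finset.sum_le_sum fun i hi => ?_
    rw [mul_assoc _ C]
    exact mul_le_mul (mul_le_mul_of_nonneg_left (hy2 i hi).le (by positivity))
      (hy1 _ (Nat.sub_le _ _) N) (norm_nonneg _) (by positivity)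
  have hlim : Tendsto (fun N : ℕ => B * q ^ N) atTop (𝓝 0) := by
    simpa using (tendsto_pow_atTop_nhds_zero_of_lt_one hq0 hq1).const_mul B
  rw [hs.nhdsWithin_eq hy₀, Metric.uniformity_eq_comap_nhds_zero,
    tendsto_comap_iff]
  simp only [Function.comp_def, dist_zero_left]
  refine squeeze_zero' (Eventually.of_forall fun _ => norm_nonneg _) ?_
    (hlim.comp tendsto_fst)
  have hN : ∀ᶠ N : ℕ in atTop, 1 ≤ N := eventually_ge_atTop 1
  filter_upwards [hN.prod_mk hbound] with p hp
  obtain ⟨N, hN⟩ := Nat.exists_eq_add_of_le' hp.1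
  have := hp.2 N
  rw [← hN] at this
  exact this

end JetNorms

/-! ### The form `F(β)` and the remainder of the series -/

noncomputable section Convergence
open AltForm

section Model
variable {E : Type*} [NormedAddCommGroup E] [NormedSpace ℝ E] [FiniteDimensional ℝ E]
  {X : Type*} [NormedAddCommGroup X] [NormedSpace ℝ X]
  {z : X → (E →L[ℝ] ℝ) [⋀^Fin 2]→L[ℝ] ℝ} {b : X → E [⋀^Fin 2]→L[ℝ] ℝ} {s : Set X}

theorem contDiffOn_modelEnd (hz : ContDiffOn ℝ ∞ z s) (hb : ContDiffOn ℝ ∞ b s) :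
    ContDiffOn ℝ ∞ (fun y => modelEnd (z y) (b y)) s := by
  have h1 : ContDiff ℝ ∞ (sharpL E) := by fun_prop
  have h2 : ContDiff ℝ ∞ (bivSharpL E) := by fun_prop
  exact (h2.comp_contDiffOn hz).clm_comp (h1.comp_contDiffOn hb)

theorem contDiffOn_inverse_one_add_modelEnd (hz : ContDiffOn ℝ ∞ z s) (hb : ContDiffOn ℝ ∞ b s)
    (hu : ∀ y ∈ s, IsUnit (1 + modelEnd (z y) (b y))) :
    ContDiffOn ℝ ∞ (fun y => Ring.inverse (1 + modelEnd (z y) (b y))) s := by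
  have : CompleteSpace E := FiniteDimensional.complete ℝ E
  intro y hy
  obtain ⟨u, hu⟩ := hu y hy
  have h := contDiffAt_ringInverse ℝ (n := ∞) u
  rw [hu] at h
  exact ContDiffAt.comp_contDiffWithinAt (f := fun y => 1 + modelEnd (z y) (b y)) y h
    (contDiffWithinAt_const.add (contDiffOn_modelEnd hz hb y hy))

omit [FiniteDimensional ℝ E] in
/-- The map `T ↦ ρ (L ∘ T ∘ S)` depends smoothly on `L` and `S`. -/
theorem contDiffOn_comp_compL_comp_flip {F G : Type*} [NormedAddCommGroup F] [NormedSpace ℝ F]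
    [NormedAddCommGroup G] [NormedSpace ℝ G] (ρ : (E →L[ℝ] G) →L[ℝ] F) {L : X → E →L[ℝ] G}
    {S : X → E →L[ℝ] E} (hL : ContDiffOn ℝ ∞ L s) (hS : ContDiffOn ℝ ∞ S s) :
    ContDiffOn ℝ ∞ (fun y => ρ.comp ((ContinuousLinearMap.compL ℝ E E G (L y)).comp
      ((ContinuousLinearMap.compL ℝ E E E).flip (S y)))) s := by
  have h2 : ContDiff ℝ ∞ (ContinuousLinearMap.compL ℝ E E G) := by fun_prop
  have h3 : ContDiff ℝ ∞ (ContinuousLinearMap.compL ℝ E E E).flip := by fun_prop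
  exact contDiffOn_const.clm_comp ((h2.comp_contDiffOn hL).clm_comp (h3.comp_contDiffOn hS))

/-- The linear map `T ↦ (b♯ ∘ T ∘ S)♭` from endomorphisms to 2-forms on `E`. -/
def sandwich (b : E [⋀^Fin 2]→L[ℝ] ℝ) (S : E →L[ℝ] E) : (E →L[ℝ] E) →L[ℝ] E [⋀^Fin 2]→L[ℝ] ℝ :=
  (unsharpL E).comp ((ContinuousLinearMap.compL ℝ E E (E →L[ℝ] ℝ) (sharpL E b)).comp
    ((ContinuousLinearMap.compL ℝ E E E).flip S))

theorem sandwich_apply (b : E [⋀^Fin 2]→L[ℝ] ℝ) (S T : E →L[ℝ] E) :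
    sandwich b S T = unsharpL E ((sharpL E b).comp (T * S)) := rfl

theorem contDiffOn_sandwich {S : X → E →L[ℝ] E} (hb : ContDiffOn ℝ ∞ b s)
    (hS : ContDiffOn ℝ ∞ S s) : ContDiffOn ℝ ∞ (fun y => sandwich (b y) (S y)) s := by
  have h1 : ContDiff ℝ ∞ (sharpL E) := by fun_prop
  exact contDiffOn_comp_compL_comp_flip (unsharpL E) (h1.comp_contDiffOn hb) hS

variable (E) in
/-- The pairs `(z, b)` for which `1 + z♯ b♯` is invertible. -/
def modelInvertibleLocus : Set (((E →L[ℝ] ℝ) [⋀^Fin 2]→L[ℝ] ℝ) × (E [⋀^Fin 2]→L[ℝ] ℝ)) :=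
  {p | IsUnit (1 + modelEnd p.1 p.2)}

theorem isOpen_modelInvertibleLocus : IsOpen (modelInvertibleLocus E) := by
  have : CompleteSpace E := FiniteDimensional.complete ℝ E
  have h := contDiffOn_modelEnd (E := E) (s := Set.univ)
    (contDiffOn_fst (𝕜 := ℝ) (n := ∞) (E := (E →L[ℝ] ℝ) [⋀^Fin 2]→L[ℝ] ℝ)
      (F := E [⋀^Fin 2]→L[ℝ] ℝ)) contDiffOn_snd
  have hc : Continuous fun p : ((E →L[ℝ] ℝ) [⋀^Fin 2]→L[ℝ] ℝ) × (E [⋀^Fin 2]→L[ℝ] ℝ) =>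
      1 + modelEnd p.1 p.2 := continuous_const.add (continuousOn_univ.1 h.continuousOn)
  exact Units.isOpen.preimage hc

/-- The smooth map `(z, b) ↦ (b♯ ∘ (1 + z♯ b♯)⁻¹)♭`. -/
def modelDirac (p : ((E →L[ℝ] ℝ) [⋀^Fin 2]→L[ℝ] ℝ) × (E [⋀^Fin 2]→L[ℝ] ℝ)) :
    E [⋀^Fin 2]→L[ℝ] ℝ :=
  sandwich p.2 1 (Ring.inverse (1 + modelEnd p.1 p.2))

theorem contDiffAt_modelDirac
    {p : ((E →L[ℝ] ℝ) [⋀^Fin 2]→L[ℝ] ℝ) × (E [⋀^Fin 2]→L[ℝ] ℝ)}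
    (hp : IsUnit (1 + modelEnd p.1 p.2)) : ContDiffAt ℝ ∞ modelDirac p := by
  have h : ContDiffOn ℝ ∞ (modelDirac (E := E)) (modelInvertibleLocus E) :=
    (contDiffOn_sandwich contDiffOn_snd contDiffOn_const).clm_apply
      (contDiffOn_inverse_one_add_modelEnd contDiffOn_fst contDiffOn_snd fun p hp => hp)
  exact h.contDiffAt (isOpen_modelInvertibleLocus.mem_nhds hp)

end Model

/-- The geometric sum in a ring in which `1 + a` is invertible. -/
theorem inverse_one_add_sub_geom_sum {R : Type*} [Ring R] {a : R} (h : IsUnit (1 + a)) (N : ℕ) :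
    Ring.inverse (1 + a) - ∑ j ∈ Finset.range N, (-a) ^ j = (-a) ^ N * Ring.inverse (1 + a) := by
  have h1 := geom_sum_mul_neg (-a) N
  rw [sub_neg_eq_add] at h1
  have h2 := congrArg (· * Ring.inverse (1 + a)) h1
  simp only [mul_assoc, Ring.mul_inverse_cancel _ h, mul_one, sub_mul, one_mul] at h2
  rw [h2]
  abel

variable {E : Type*} [NormedAddCommGroup E] [NormedSpace ℝ E] [FiniteDimensional ℝ E]
  {M : Type*} [TopologicalSpace M] [ChartedSpace E M] [IsManifold 𝓘(ℝ, E) ∞ M]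

omit [FiniteDimensional ℝ E] in
theorem ContMDiffOn.contDiffOn_comp_chartAt_symm {G : Type*} [NormedAddCommGroup G]
    [NormedSpace ℝ G] {f : M → G} {x₀ : M}
    (hf : ContMDiffOn 𝓘(ℝ, E) 𝓘(ℝ, G) ∞ f (chartAt E x₀).source) :
    ContDiffOn ℝ ∞ (fun y => f ((chartAt E x₀).symm y)) (chartAt E x₀).target :=
  contMDiffOn_iff_contDiffOn.1
    (hf.comp (contMDiffOn_chart_symm (I := 𝓘(ℝ, E))) fun _ hy => (chartAt E x₀).map_target hy)

/-- If `a♯ = β♯ T`, the same holds in coordinates. -/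
theorem localForm_eq_of_formSharp_eq (x₀ x : M) (hx : x ∈ (chartAt E x₀).source)
    (a β : ∀ x, AltFiber E M 2 x) (T : Module.End ℝ (TangentSpace 𝓘(ℝ, E) x))
    (h : formSharp (a x) = formSharp (β x) ∘ₗ T) :
    localForm x₀ a x =
      sandwich (localForm x₀ β x) 1 (conjEnd (frameAt x₀ x hx) T) := by
  rw [sandwich_apply, mul_one, localForm_eq_frameAt x₀ x hx a, localForm_eq_frameAt x₀ x hx β,
    ← sharpL_comp (frameAt x₀ x hx) (a x) (β x) T h, unsharpL_sharpL]

theorem modelEnd_local (Z : Bivector E M) (β : DForm E M 2) (x₀ x : M)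
    (hx : x ∈ (chartAt E x₀).source) :
    modelEnd (localBiv x₀ Z x) (localForm x₀ β x) =
      conjEnd (frameAt x₀ x hx) (sharpEnd Z β x) := by
  rw [localForm_eq_frameAt x₀ x hx β, modelEnd_localBiv]

theorem isUnit_one_add_modelEnd (Z : Bivector E M) (β : DForm E M 2) (x₀ x : M)
    (hx : x ∈ (chartAt E x₀).source) (hu : IsUnit (1 + sharpEnd Z β x)) :
    IsUnit (1 + modelEnd (localBiv x₀ Z x) (localForm x₀ β x)) := by
  rw [modelEnd_local Z β x₀ x hx, ← map_one (conjEnd (frameAt x₀ x hx)), ← map_add]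
  exact hu.map _

theorem localForm_diracForm (Z : Bivector E M) (β : DForm E M 2) (x₀ x : M)
    (hx : x ∈ (chartAt E x₀).source) :
    localForm x₀ (fun x => diracForm (Z x) (β x)) x =
      modelDirac (localBiv x₀ Z x, localForm x₀ β x) := by
  rw [localForm_eq_of_formSharp_eq x₀ x hx _ β (Ring.inverse (1 + sharpEnd Z β x))
      (formSharp_diracForm (Z x) (β x)), conjEnd_ringInverse, map_add, map_one, modelDirac,
    modelEnd_local Z β x₀ x hx]

/-- The smooth 2-form `F(β)` for a 2-form `β` with values in `I_Z`. -/
def diracDForm (Z : Bivector E M) (β : DForm E M 2) (hu : ∀ x, IsUnit (1 + sharpEnd Z β x)) :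
    DForm E M 2 where
  toFun x := diracForm (Z x) (β x)
  contMDiff_toFun := by
    refine (contMDiff_iff_localForm _).2 fun x₀ => ?_
    have hx₀ := mem_chart_source E x₀
    have h := contDiffAt_modelDirac (p := (localBiv x₀ Z x₀, localForm x₀ β x₀))
      (isUnit_one_add_modelEnd Z β x₀ x₀ hx₀ (hu x₀))
    refine (ContMDiffAt.comp (g := modelDirac) x₀ h.contMDiffAt
      ((contMDiffAt_localBiv Z x₀).prodMk_space
        ((contMDiff_iff_localForm _).1 β.contMDiff x₀))).congr_of_eventuallyEq ?_
    filter_upwards [(chartAt E x₀).open_source.mem_nhds hx₀] with x hx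
    exact localForm_diracForm Z β x₀ x hx

theorem diracDForm_apply (Z : Bivector E M) (β : DForm E M 2)
    (hu : ∀ x, IsUnit (1 + sharpEnd Z β x)) (x : M) :
    diracDForm Z β hu x = diracForm (Z x) (β x) := rfl

/-- The sharp map of a partial sum of the series `ψ_*(β)`. -/
theorem formSharp_sum_psiTerm (Z : Bivector E M) (β : DForm E M 2) (N : ℕ) (x : M) :
    formSharp ((∑ k ∈ Finset.Icc 1 N, psiTerm Z β k : DForm E M 2) x) =
      formSharp (β x) ∘ₗ ∑ j ∈ Finset.range N, (-sharpEnd Z β x) ^ j := by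
  induction N with
  | zero =>
    simp only [Finset.Icc_eq_empty (show ¬ 1 ≤ 0 by decide), Finset.sum_empty, Finset.range_zero,
      LinearMap.comp_zero]
    rfl
  | succ N ih =>
    rw [Finset.sum_Icc_succ_top (by omega), Finset.sum_range_succ, LinearMap.comp_add, ← ih,
      psiTerm_succ, ← neg_one_smul ℝ (sharpEnd Z β x), smul_pow, LinearMap.comp_smul,
      ← formSharp_geomForm]
    rfl

/-- The remainder of the series `ψ_*(β)` in coordinates. -/
theorem localForm_remainder (Z : Bivector E M) (β : DForm E M 2)
    (hu : ∀ x, IsUnit (1 + sharpEnd Z β x)) (x₀ x : M) (hx : x ∈ (chartAt E x₀).source) (N : ℕ) :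
    localForm x₀ (diracDForm Z β hu) x -
        localForm x₀ (∑ k ∈ Finset.Icc 1 N, psiTerm Z β k : DForm E M 2) x =
      sandwich (localForm x₀ β x)
        (Ring.inverse (1 + modelEnd (localBiv x₀ Z x) (localForm x₀ β x)))
        ((-modelEnd (localBiv x₀ Z x) (localForm x₀ β x)) ^ N) := by
  have h1 := localForm_diracForm Z β x₀ x hx
  have h2 := localForm_eq_of_formSharp_eq x₀ x hx _ β _ (formSharp_sum_psiTerm Z β N x)
  rw [modelDirac] at h1
  refine (congrArg₂ (· - ·) h1 h2).trans ?_
  have h3 : ∀ S T : E →L[ℝ] E, sandwich (localForm x₀ β x) S T =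
      sandwich (localForm x₀ β x) 1 (T * S) := fun S T => by
    rw [sandwich_apply, sandwich_apply, mul_one]
  rw [h3 (Ring.inverse _), modelEnd_local Z β x₀ x hx, ← map_one (conjEnd (frameAt x₀ x hx)), ← map_add,
    ← conjEnd_ringInverse, ← map_neg, ← map_pow, ← map_mul, ← inverse_one_add_sub_geom_sum (hu x),
    map_sub, map_sub]

end Convergence

/-! ### Convergence -/

noncomputable section SmoothConvergence
open AltForm

variable {E : Type*} [NormedAddCommGroup E] [NormedSpace ℝ E] [FiniteDimensional ℝ E]

/-- The Neumann series for `(1 + A)⁻¹`, composed with a linear map. -/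
theorem hasSum_neumann {V : Type*} [AddCommGroup V] [Module ℝ V] [TopologicalSpace V]
    {W : Type*} [AddCommGroup W] [Module ℝ W] [TopologicalSpace W] [IsTopologicalAddGroup W]
    [ContinuousSMul ℝ W] (φ : E ≃L[ℝ] V) (A : Module.End ℝ V) (h : ‖conjEnd φ A‖ < 1)
    (L : V →ₗ[ℝ] W) (v : V) :
    HasSum (fun j : ℕ => (-1 : ℝ) ^ j • L ((A ^ j) v)) (L (Ring.inverse (1 + A) v)) := by
  have : CompleteSpace E := FiniteDimensional.complete ℝ E
  have h1 : HasSum (fun j : ℕ => (conjEnd φ (-A)) ^ j) (Ring.inverse (1 - conjEnd φ (-A))) :=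
    hasSum_geom_series_inverse _ (by rwa [map_neg, norm_neg])
  have e1 : 1 - conjEnd φ (-A) = conjEnd φ (1 + A) := by
    rw [map_neg, map_add, map_one, sub_neg_eq_add]
  rw [e1, ← conjEnd_ringInverse] at h1
  let Λ : E →L[ℝ] W := ⟨L ∘ₗ φ.toLinearEquiv.toLinearMap,
    LinearMap.continuous_of_finiteDimensional _⟩
  have h2 := (h1.mapL (ContinuousLinearMap.apply ℝ E (φ.symm v))).mapL Λ
  convert h2 using 1
  · funext j
    rw [← map_pow]
    change _ = L (φ (conjEnd φ ((-A) ^ j) (φ.symm v)))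
    rw [conjEnd_apply, φ.apply_symm_apply, φ.apply_symm_apply, ← neg_one_smul ℝ A, smul_pow,
      LinearMap.smul_apply, map_smul]
  · change _ = L (φ (conjEnd φ (Ring.inverse (1 + A)) (φ.symm v)))
    rw [conjEnd_apply, φ.apply_symm_apply, φ.apply_symm_apply]

variable {M : Type*} [TopologicalSpace M] [ChartedSpace E M] [IsManifold 𝓘(ℝ, E) ∞ M]

/-- Convergence in the `C^∞` topology amounts to local uniform convergence of all derivatives of the
differences to zero in all charts. -/
theorem tendsto_cInfTopology_two {a : ℕ → DForm E M 2} {α : DForm E M 2}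
    (h : ∀ (x₀ : M) (r : ℕ), TendstoLocallyUniformlyOn
      (fun N => iteratedFDeriv ℝ r fun y => localForm x₀ α ((chartAt E x₀).symm y) -
        localForm x₀ (a N) ((chartAt E x₀).symm y))
      (fun _ => 0) atTop (chartAt E x₀).target) :
    Tendsto a atTop (@nhds _ (cInfTopology E M 2) α) := by
  rw [nhds_iInf, tendsto_iInf]
  intro x₀
  rw [nhds_iInf, tendsto_iInf]
  intro r
  rw [nhds_induced, tendsto_comap_iff, UniformOnFun.tendsto_iff_tendstoUniformlyOn]
  rintro K ⟨hK, hKs⟩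
  have h1 := (tendstoLocallyUniformlyOn_iff_tendstoUniformlyOn_of_compact hK).1 ((h x₀ r).mono hKs)
  rw [Metric.tendstoUniformlyOn_iff] at h1 ⊢
  intro ε hε
  filter_upwards [h1 ε hε] with N hN y hy
  have hd : ∀ a : DForm E M 2, ContDiffAt ℝ r
      (fun y => localForm x₀ a ((chartAt E x₀).symm y)) y := fun a =>
    ((contMDiffOn_localForm_two x₀ a).contDiffOn_comp_chartAt_symm.contDiffAt
      ((chartAt E x₀).open_target.mem_nhds (hKs hy))).of_le (by exact_mod_cast le_top)
  have h2 := hN y hy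
  rw [fun_iteratedFDeriv_sub_apply (hd α) (hd (a N)), dist_zero_left] at h2
  rw [dist_eq_norm]
  exact h2

/-- If the endomorphisms `Z♯ β♯` are conjugate to endomorphisms of norm less than one, the series
`ψ_*(β)` converges to `F(β)` in the `C^∞` topology. -/
theorem tendsto_sum_psiTerm (Z : Bivector E M) (β : DForm E M 2)
    (hu : ∀ x, IsUnit (1 + sharpEnd Z β x))
    (hβ : ∀ x, ∃ φ : E ≃L[ℝ] TangentSpace 𝓘(ℝ, E) x, ‖conjEnd φ (sharpEnd Z β x)‖ < 1) :
    Tendsto (fun N => ∑ k ∈ Finset.Icc 1 N, psiTerm Z β k) atTop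
      (@nhds _ (cInfTopology E M 2) (diracDForm Z β hu)) := by
  refine tendsto_cInfTopology_two fun x₀ r => ?_
  have hs := (chartAt E x₀).open_target
  have hmap : ∀ y ∈ (chartAt E x₀).target, (chartAt E x₀).symm y ∈ (chartAt E x₀).source :=
    fun y hy => (chartAt E x₀).map_target hy
  have hz := (contMDiffOn_localBiv x₀ Z).contDiffOn_comp_chartAt_symm
  have hb := (contMDiffOn_localForm_two x₀ β).contDiffOn_comp_chartAt_symm
  have hinv := contDiffOn_inverse_one_add_modelEnd hz hb fun y hy =>
    isUnit_one_add_modelEnd Z β x₀ _ (hmap y hy) (hu _)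
  refine (tendstoLocallyUniformlyOn_iteratedFDeriv_clm_apply_pow hs
    (contDiffOn_modelEnd hz hb).neg (contDiffOn_sandwich hb hinv) ?_ r).congr ?_
  · intro y hy
    obtain ⟨φ, hφ⟩ := hβ ((chartAt E x₀).symm y)
    set ψ := frameAt x₀ _ (hmap y hy) with hψ
    set g : E ≃L[ℝ] E := φ.trans ψ.symm with hg
    have hgφ : g.trans ψ = φ := by ext v; simp [hg]
    refine ⟨ContinuousLinearEquiv.toUnit g, ?_⟩
    rw [← hgφ, conjEnd_trans, hψ, ← modelEnd_local Z β x₀ _ (hmap y hy)] at hφ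
    rw [mul_neg, neg_mul, norm_neg]
    exact hφ
  · intro N y hy
    refine Filter.EventuallyEq.eq_of_nhds (Filter.EventuallyEq.iteratedFDeriv ℝ ?_ r)
    filter_upwards [hs.mem_nhds hy] with y hy
    exact (localForm_remainder Z β hu x₀ _ (hmap y hy) N).symm

end SmoothConvergence

theorem mainTheorem5
    {E : Type*} [NormedAddCommGroup E] [NormedSpace ℝ E] [FiniteDimensional ℝ E]
    {M : Type*} [TopologicalSpace M] [T2Space M] [SecondCountableTopology M] [ChartedSpace E M]
    [IsManifold 𝓘(ℝ, E) ∞ M] (Z : Bivector E M) :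
    -- `ψₖ(β ⊙ ⋯ ⊙ β)` is a 2-form
    (∀ (β : DForm E M 2) (k : ℕ), (psiCoeff Z k fun _ => homForm E M 2 β) =
      homForm E M 2 ((psiCoeff Z k fun _ => homForm E M 2 β) 2)) ∧
    -- the sharp maps of the terms of the series
    (∀ (β : DForm E M 2) (j : ℕ) (x : M), AltForm.formSharp (psiTerm Z β (j + 1) x) =
      (-1 : ℝ) ^ j • (AltForm.formSharp (β x) ∘ₗ
        (AltForm.bivectorSharp (Z x) ∘ₗ AltForm.formSharp (β x) :
          Module.End ℝ (TangentSpace 𝓘(ℝ, E) x)) ^ j)) ∧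
    -- convergence for all `β` with values in a neighbourhood `U` of the zero section
    ∃ U : Set (TotalSpace (E [⋀^Fin 2]→L[ℝ] ℝ) (AltFiber E M 2)),
      IsOpen U ∧ (∀ x : M, TotalSpace.mk x 0 ∈ U) ∧ U ⊆ invertibleLocus Z ∧
      ∀ β : DForm E M 2, (∀ x, TotalSpace.mk x (β x) ∈ U) →
        ∃ α : DForm E M 2,
          (∀ x, α x = AltForm.diracForm (Z x) (β x)) ∧
          (∀ x, AltForm.formSharp (α x) = AltForm.formSharp (β x) ∘ₗ
            Ring.inverse (1 + AltForm.bivectorSharp (Z x) ∘ₗ AltForm.formSharp (β x) :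
              Module.End ℝ (TangentSpace 𝓘(ℝ, E) x))) ∧
          Tendsto (fun N => ∑ k ∈ Finset.Icc 1 N, psiTerm Z β k) atTop
            (@nhds _ (cInfTopology E M 2) α) ∧
          ∀ (x : M) (v : TangentSpace 𝓘(ℝ, E) x), HasSum
            (fun j : ℕ => (-1 : ℝ) ^ j • AltForm.formSharp (β x)
              (((AltForm.bivectorSharp (Z x) ∘ₗ AltForm.formSharp (β x) :
                Module.End ℝ (TangentSpace 𝓘(ℝ, E) x)) ^ j) v)) (AltForm.formSharp (α x) v) := by
  refine ⟨psiCoeff_eq_homForm Z, fun β j x => ?_, smallLocus Z, isOpen_smallLocus Z,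
    zero_mem_smallLocus Z, smallLocus_subset Z, fun β hβ => ?_⟩
  · rw [psiTerm_succ]
    exact formSharp_geomForm Z β j x
  · have hβ' : ∀ x, ∃ φ : E ≃L[ℝ] TangentSpace 𝓘(ℝ, E) x,
        ‖AltForm.conjEnd φ (sharpEnd Z β x)‖ < 1 := hβ
    have hu : ∀ x, IsUnit (1 + sharpEnd Z β x) := fun x =>
      (hβ' x).elim fun φ hφ => AltForm.isUnit_one_add_of_norm_conjEnd_lt_one φ _ hφ
    refine ⟨diracDForm Z β hu, diracDForm_apply Z β hu, fun x => ?_, tendsto_sum_psiTerm Z β hu hβ',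
      fun x v => ?_⟩
    · rw [diracDForm_apply, AltForm.formSharp_diracForm]
    obtain ⟨φ, hφ⟩ := hβ' x
    exact hasSum_neumann φ (sharpEnd Z β x) hφ (AltForm.formSharp (β x)) v
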